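/- Let $\mathcal H$ be a real or complex Hilbert space, let $P$ be a contraction on $\mathcal H$ (a bounded linear operator with $\|P\|\le 1$), and let $0\le \alpha<1$. For $f\in\mathcal H$ consider the following properties: (i) the series $\sum_{n\ge 0}(n+1)^{-\alpha}P^nf$ converges in $\mathcal H$, i.e. its partial sums $\sum_{n=0}^{N}(n+1)^{-\alpha}P^nf$ converge in norm as $N\to\infty$; (ii) $\sum_{n\ge 0}(n+1)^{1-2\alpha}\|P^nf\|_{\mathcal H}^2<\infty$. Then, for every $f\in\mathcal H$, (ii) implies (i). If moreover $P$ is Ritt, i.e. $\sup_{n\in\mathbb N}n\|P^n-P^{n+1}\|<\infty$, then, for every $f\in\mathcal H$, (i) implies (ii). -/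

import Mathlib

open Filter Topology

/-- The Ritt condition `sup_n n ‖Pⁿ - Pⁿ⁺¹‖ < ∞` (operator norm) for a bounded operator `P`. -/
def IsRitt {𝕜 H : Type*} [RCLike 𝕜] [NormedAddCommGroup H] [InnerProductSpace 𝕜 H]
    (P : H →L[𝕜] H) : Prop :=
  BddAbove (Set.range fun n : ℕ => (n : ℝ) * ‖P ^ n - P ^ (n + 1)‖)

/-- Norm convergence of the series `∑ uₙ`, i.e. convergence of the ordered partial sums
`u₀ + ⋯ + u_{N-1}` (no unconditional convergence is required). -/
def SeriesConverges {H : Type*} [NormedAddCommGroup H] (u : ℕ → H) : Prop :=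
  ∃ g : H, Tendsto (fun N : ℕ => ∑ n ∈ Finset.range N, u n) atTop (𝓝 g)

/-! Write d(x) = ‖(1 - P⋆P)^{1/2} x‖, so that d(x)² = ‖x‖² - ‖Px‖² telescopes along orbits, and A(z)
= Σ (n+1)^(-α) zⁿ.

(ii) ⇒ (i). For a block x = Σ_{M≤n<N} (n+1)^(-α) Pⁿf, ‖x‖² equals Σ_{j<J} d(P^j x)² plus ‖P^J x‖²,
and the last term vanishes as J → ∞. Since d is a seminorm, d(P^j x) is at most a fractional
integral of the sequence d(P^m f), m ≥ M. A Schur test bounds this in ℓ² by the tail of Σ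
(m+1)^(2-2α) d(P^m f)² (`norm_sq_sum_Ico_le`), a series that converges by (ii) and Abel summation
(`summable_rpow_mul_defect_sq`). Hence the partial sums are Cauchy.

(i) ⇒ (ii). Only boundedness of the partial sums g_L of A(P)f is used. By Kaluza's theorem 1/A has
nonpositive coefficients after the first, so 1/A(z) = (1-z) Σ Bₙzⁿ with Bₙ ≥ 0 decreasing and Bₙ ≤
(n+1)^(α-1). Truncations of this series at P behave like (1-P)^(1-α), and applied to g_L they
recover f in the limit (`tendsto_fracDiff_apply_sum`). Since ‖Pⁿf‖ decreases, (ii) is a dyadic sum,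
and it suffices to bound Σ_k ‖2^(k(1-α)) P^(2·2^k) (1-P)^(1-α) g‖² by a multiple of ‖g‖², uniformly
in the truncation (`exists_sum_norm_sq_dyadicFracDiff_le`).

That square function estimate is an almost-orthogonality argument. The resolvents U_t =
(1+t(1-P))⁻¹, t = 2^j, split the identity into bands. The differences U_{2^j} - U_{2^{j+1}} are
square summable for every contraction, because 1 - P is accretive; the Ritt condition makes the
interaction of scale k with band j decay like 2^(-(1-α)|k-j|). -/

/-- Schur test for a nonnegative kernel on finite index sets. -/
theorem schur_test {ι κ : Type*} (s : Finset ι) (t : Finset κ) (K : ι → κ → ℝ)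
    (u : κ → ℝ) (v : ι → ℝ) (A B : ℝ) (hK : ∀ i ∈ s, ∀ j ∈ t, 0 ≤ K i j)
    (hu : ∀ j ∈ t, 0 < u j) (hA : 0 ≤ A)
    (hrow : ∀ i ∈ s, ∑ j ∈ t, K i j * u j ≤ A * v i)
    (hcol : ∀ j ∈ t, ∑ i ∈ s, K i j * v i ≤ B * u j) (x : κ → ℝ) :
    ∑ i ∈ s, (∑ j ∈ t, K i j * x j) ^ 2 ≤ A * B * ∑ j ∈ t, x j ^ 2 := by
  -- Cauchy–Schwarz with the splitting K|x| = (K u)^{1/2} (K x²/u)^{1/2}.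
  have h1 : ∀ i ∈ s, (∑ j ∈ t, K i j * x j) ^ 2
      ≤ A * v i * ∑ j ∈ t, K i j * x j ^ 2 / u j := by
    intro i hi
    have hcs : (∑ j ∈ t, K i j * x j) ^ 2
        ≤ (∑ j ∈ t, K i j * u j) * ∑ j ∈ t, K i j * x j ^ 2 / u j := by
      apply Finset.sum_sq_le_sum_mul_sum_of_sq_le_mul
      · intro j hj
        exact mul_nonneg (hK i hi j hj) (hu j hj).le
      · intro j hj
        exact div_nonneg (mul_nonneg (hK i hi j hj) (sq_nonneg _)) (hu j hj).le
      · intro j hj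
        refine le_of_eq ?_
        have := (hu j hj).ne'
        field_simp
    refine hcs.trans (mul_le_mul_of_nonneg_right (hrow i hi) ?_)
    exact Finset.sum_nonneg fun j hj =>
      div_nonneg (mul_nonneg (hK i hi j hj) (sq_nonneg _)) (hu j hj).le
  refine (Finset.sum_le_sum h1).trans ?_
  have h2 : ∑ i ∈ s, A * v i * ∑ j ∈ t, K i j * x j ^ 2 / u j
      = ∑ j ∈ t, A * (x j ^ 2 / u j) * ∑ i ∈ s, K i j * v i := by
    simp_rw [Finset.mul_sum]
    rw [Finset.sum_comm]
    refine Finset.sum_congr rfl fun j _ => Finset.sum_congr rfl fun i _ => ?_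
    ring
  rw [h2, Finset.mul_sum]
  refine Finset.sum_le_sum fun j hj => ?_
  have hpos := hu j hj
  calc A * (x j ^ 2 / u j) * ∑ i ∈ s, K i j * v i
      ≤ A * (x j ^ 2 / u j) * (B * u j) :=
        mul_le_mul_of_nonneg_left (hcol j hj) (by positivity)
    _ = A * B * x j ^ 2 := by field_simp

/-! ### Power sums and the fractional-integration kernel -/

theorem mul_rpow_neg_le_rpow_sub_rpow {s : ℝ} (hs0 : 0 ≤ s) (hs1 : s < 1) (n : ℕ) :
    (1 - s) * ((n : ℝ) + 1) ^ (-s) ≤ ((n : ℝ) + 1) ^ (1 - s) - (n : ℝ) ^ (1 - s) := by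
  have hx : (0 : ℝ) < (n : ℝ) + 1 := by positivity
  -- Bernoulli for an exponent in (0, 1], at the ratio n/(n+1) of consecutive bases.
  have hb : (1 + (-1 / ((n : ℝ) + 1))) ^ (1 - s) ≤ 1 + (1 - s) * (-1 / ((n : ℝ) + 1)) := by
    apply rpow_one_add_le_one_add_mul_self _ (by linarith) (by linarith)
    rw [neg_div, neg_le_neg_iff, div_le_one hx]
    linarith [n.cast_nonneg (α := ℝ)]
  have he : 1 + (-1 / ((n : ℝ) + 1)) = n / (n + 1) := by field_simp; ring
  have hn : (n : ℝ) ^ (1 - s)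
      = ((n : ℝ) + 1) ^ (1 - s) * (1 + (-1 / ((n : ℝ) + 1))) ^ (1 - s) := by
    rw [he, ← Real.mul_rpow hx.le (by positivity)]
    congr 1; field_simp
  have hr : ((n : ℝ) + 1) ^ (-s) = ((n : ℝ) + 1) ^ (1 - s) * (1 / ((n : ℝ) + 1)) := by
    rw [show -s = (1 - s) - 1 by ring, Real.rpow_sub_one hx.ne']; ring
  have hp : 0 ≤ ((n : ℝ) + 1) ^ (1 - s) := by positivity
  rw [hn, hr]
  have := mul_le_mul_of_nonneg_left hb hp
  calc _ = ((n : ℝ) + 1) ^ (1 - s) - ((n : ℝ) + 1) ^ (1 - s) *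
        (1 + (1 - s) * (-1 / ((n : ℝ) + 1))) := by ring
    _ ≤ _ := by linarith

theorem sum_range_rpow_neg_le {s : ℝ} (hs0 : 0 ≤ s) (hs1 : s < 1) (n : ℕ) :
    ∑ i ∈ Finset.range n, ((i : ℝ) + 1) ^ (-s) ≤ (1 - s)⁻¹ * (n : ℝ) ^ (1 - s) := by
  have h1 : 0 < 1 - s := by linarith
  rw [inv_mul_eq_div, le_div_iff₀' h1]
  induction n with
  | zero => simp [Real.zero_rpow h1.ne']
  | succ n ih =>
    rw [Finset.sum_range_succ, mul_add]
    push_cast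
    linarith [mul_rpow_neg_le_rpow_sub_rpow hs0 hs1 n]

/-- A telescoping majorant; with u = 1/x ≤ 1 it reduces to (1+u)^(-1/2) ≤ 1 - u/4. -/
theorem rpow_neg_three_halves_le (x : ℝ) (hx : 1 ≤ x) :
    x ^ (-(3 / 2) : ℝ) ≤ 4 * x ^ (-(1 / 2) : ℝ) - 4 * (x + 1) ^ (-(1 / 2) : ℝ) := by
  have hx0 : 0 < x := by linarith
  have e1 : x ^ (-(3 / 2) : ℝ) = x ^ (-(1 / 2) : ℝ) * (1 / x) := by
    rw [show (-(3 / 2) : ℝ) = -(1 / 2) - 1 by norm_num, Real.rpow_sub_one hx0.ne']; ring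
  have e2 : x + 1 = x * (1 + 1 / x) := by field_simp
  have hu : 1 / x ≤ 1 := by rw [div_le_one hx0]; exact hx
  have hu0 : 0 ≤ 1 / x := by positivity
  rw [e1, e2, Real.mul_rpow hx0.le (by positivity)]
  generalize 1 / x = u at *
  have hb : (1 + u) ^ (-(1 / 2) : ℝ) ≤ 1 - u / 4 := by
    rw [Real.rpow_neg (by positivity), ← Real.sqrt_eq_rpow,
      inv_le_comm₀ (by positivity) (by linarith)]
    apply Real.le_sqrt_of_sq_le
    rw [inv_pow, inv_le_iff_one_le_mul₀ (by nlinarith)]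
    nlinarith [mul_nonneg hu0 hu0, mul_nonneg hu0 (sub_nonneg.2 hu),
      mul_nonneg (mul_nonneg hu0 hu0) hu0]
  have hp : 0 ≤ x ^ (-(1 / 2) : ℝ) := by positivity
  nlinarith [mul_le_mul_of_nonneg_left hb hp]

theorem sum_Ico_rpow_neg_three_halves_le (j n : ℕ) :
    ∑ i ∈ Finset.Ico j n, ((i : ℝ) + 1) ^ (-(3 / 2) : ℝ) ≤ 4 * ((j : ℝ) + 1) ^ (-(1 / 2) : ℝ) := by
  rcases le_total n j with h | h
  · rw [Finset.Ico_eq_empty_of_le h, Finset.sum_empty]; positivity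
  have h1 : ∑ i ∈ Finset.Ico j n, ((i : ℝ) + 1) ^ (-(3 / 2) : ℝ)
      ≤ 4 * ((j : ℝ) + 1) ^ (-(1 / 2) : ℝ) - 4 * ((n : ℝ) + 1) ^ (-(1 / 2) : ℝ) := by
    induction n, h using Nat.le_induction with
    | base => simp
    | succ n h ih =>
      rw [Finset.sum_Ico_succ_top h]
      have := rpow_neg_three_halves_le ((n : ℝ) + 1) (by linarith [n.cast_nonneg (α := ℝ)])
      push_cast
      linarith
  have : (0 : ℝ) ≤ 4 * ((n : ℝ) + 1) ^ (-(1 / 2) : ℝ) := by positivity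
  linarith

/-- Needed for γ = 2 - 2α, where the exponent 1 - 2α of the summand changes sign at α = 1/2; hence
two cases. For γ ≤ 1 the last summand is the smallest. For γ ≥ 1 Bernoulli bounds each increment of
n^γ by γ ≤ 2 times the summand. -/
theorem rpow_le_two_mul_sum_range {γ : ℝ} (h0 : 0 < γ) (h2 : γ ≤ 2) (n : ℕ) :
    (n : ℝ) ^ γ ≤ 2 * ∑ i ∈ Finset.range n, ((i : ℝ) + 1) ^ (γ - 1) := by
  rcases le_total γ 1 with h | h
  · rcases Nat.eq_zero_or_pos n with rfl | hn
    · simp [Real.zero_rpow h0.ne']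
    have hn' : (0 : ℝ) < n := by exact_mod_cast hn
    have h1 : ∑ i ∈ Finset.range n, (n : ℝ) ^ (γ - 1)
        ≤ ∑ i ∈ Finset.range n, ((i : ℝ) + 1) ^ (γ - 1) := by
      refine Finset.sum_le_sum fun i hi => ?_
      apply Real.rpow_le_rpow_of_nonpos (by positivity) _ (by linarith)
      exact_mod_cast Finset.mem_range.1 hi
    have h3 : ∑ i ∈ Finset.range n, (n : ℝ) ^ (γ - 1) = (n : ℝ) ^ γ := by
      rw [Finset.sum_const, Finset.card_range, nsmul_eq_mul, Real.rpow_sub_one hn'.ne']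
      field_simp
    have h4 : 0 ≤ (n : ℝ) ^ γ := by positivity
    linarith
  · induction n with
    | zero => simp [Real.zero_rpow h0.ne']
    | succ n ih =>
      rw [Finset.sum_range_succ]
      have hx : (0 : ℝ) < (n : ℝ) + 1 := by positivity
      have hb : 1 + γ * (-1 / ((n : ℝ) + 1)) ≤ (1 + (-1 / ((n : ℝ) + 1))) ^ γ := by
        apply one_add_mul_self_le_rpow_one_add _ h
        rw [neg_div, neg_le_neg_iff, div_le_one hx]
        linarith [n.cast_nonneg (α := ℝ)]
      have he : 1 + (-1 / ((n : ℝ) + 1)) = n / (n + 1) := by field_simp; ring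
      have hn : (n : ℝ) ^ γ = ((n : ℝ) + 1) ^ γ * (1 + (-1 / ((n : ℝ) + 1))) ^ γ := by
        rw [he, ← Real.mul_rpow hx.le (by positivity)]
        congr 1; field_simp
      have hr : ((n : ℝ) + 1) ^ (γ - 1) = ((n : ℝ) + 1) ^ γ * (1 / ((n : ℝ) + 1)) := by
        rw [Real.rpow_sub_one hx.ne']; ring
      have hp : 0 ≤ ((n : ℝ) + 1) ^ γ := by positivity
      have h3 := mul_le_mul_of_nonneg_left hb hp
      have h4 : ((n : ℝ) + 1) ^ γ * (1 + γ * (-1 / ((n : ℝ) + 1)))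
          = ((n : ℝ) + 1) ^ γ - γ * ((n : ℝ) + 1) ^ (γ - 1) := by rw [hr]; ring
      have h5 : γ * ((n : ℝ) + 1) ^ (γ - 1) ≤ 2 * ((n : ℝ) + 1) ^ (γ - 1) := by gcongr
      push_cast
      linarith

/-- Row sums of the fractional-integration kernel `(i+1)^(-α) (i+j+1)^(α-1)` against the weight
`(·+1)^(-1/2)`. -/
theorem sum_range_fractional_kernel_row_le {α : ℝ} (h0 : 0 ≤ α) (h1 : α < 1) (j n : ℕ) :
    ∑ i ∈ Finset.range n, ((i : ℝ) + 1) ^ (-α) * ((i : ℝ) + j + 1) ^ (α - 3 / 2)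
      ≤ ((1 - α)⁻¹ + 4) * ((j : ℝ) + 1) ^ (-(1 / 2) : ℝ) := by
  have hj : (0 : ℝ) < (j : ℝ) + 1 := by positivity
  have hterm1 : ∀ i : ℕ, ((i : ℝ) + 1) ^ (-α) * ((i : ℝ) + j + 1) ^ (α - 3 / 2)
      ≤ ((j : ℝ) + 1) ^ (α - 3 / 2) * ((i : ℝ) + 1) ^ (-α) := by
    intro i
    rw [mul_comm]
    gcongr ?_ * _
    apply Real.rpow_le_rpow_of_nonpos hj _ (by linarith)
    linarith [i.cast_nonneg (α := ℝ)]
  have hterm2 : ∀ i : ℕ, ((i : ℝ) + 1) ^ (-α) * ((i : ℝ) + j + 1) ^ (α - 3 / 2)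
      ≤ ((i : ℝ) + 1) ^ (-(3 / 2) : ℝ) := by
    intro i
    have hi : (0 : ℝ) < (i : ℝ) + 1 := by positivity
    calc _ ≤ ((i : ℝ) + 1) ^ (-α) * ((i : ℝ) + 1) ^ (α - 3 / 2) := by
          gcongr _ * ?_
          apply Real.rpow_le_rpow_of_nonpos hi _ (by linarith)
          linarith [j.cast_nonneg (α := ℝ)]
      _ = _ := by rw [← Real.rpow_add hi]; congr 1; ring
  have hnn : ∀ i : ℕ, 0 ≤ ((i : ℝ) + 1) ^ (-α) * ((i : ℝ) + j + 1) ^ (α - 3 / 2) := by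
    intro i; positivity
  -- Split at i = j: up to there the second factor is frozen at i = 0, beyond it the term is
  -- compared with (i+1)^(-3/2).
  calc ∑ i ∈ Finset.range n, ((i : ℝ) + 1) ^ (-α) * ((i : ℝ) + j + 1) ^ (α - 3 / 2)
      ≤ ∑ i ∈ Finset.range (j + 1) ∪ Finset.Ico (j + 1) n,
          ((i : ℝ) + 1) ^ (-α) * ((i : ℝ) + j + 1) ^ (α - 3 / 2) := by
        apply Finset.sum_le_sum_of_subset_of_nonneg
        · intro i hi
          simp only [Finset.mem_union, Finset.mem_range, Finset.mem_Ico] at *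
          omega
        · intro i _ _; exact hnn i
    _ = ∑ i ∈ Finset.range (j + 1), ((i : ℝ) + 1) ^ (-α) * ((i : ℝ) + j + 1) ^ (α - 3 / 2)
        + ∑ i ∈ Finset.Ico (j + 1) n,
          ((i : ℝ) + 1) ^ (-α) * ((i : ℝ) + j + 1) ^ (α - 3 / 2) := by
        apply Finset.sum_union
        rw [Finset.disjoint_left]
        intro i hi
        simp only [Finset.mem_range, Finset.mem_Ico] at *
        omega
    _ ≤ ∑ i ∈ Finset.range (j + 1), ((j : ℝ) + 1) ^ (α - 3 / 2) * ((i : ℝ) + 1) ^ (-α)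
        + ∑ i ∈ Finset.Ico (j + 1) n, ((i : ℝ) + 1) ^ (-(3 / 2) : ℝ) :=
        add_le_add (Finset.sum_le_sum fun i _ => hterm1 i) (Finset.sum_le_sum fun i _ => hterm2 i)
    _ ≤ ((j : ℝ) + 1) ^ (α - 3 / 2) * ((1 - α)⁻¹ * ((j : ℝ) + 1) ^ (1 - α))
        + 4 * ((j : ℝ) + 1) ^ (-(1 / 2) : ℝ) := by
        rw [← Finset.mul_sum]
        gcongr ?_ + ?_
        · gcongr
          have := sum_range_rpow_neg_le h0 h1 (j + 1)
          push_cast at this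
          exact this
        · refine (sum_Ico_rpow_neg_three_halves_le (j + 1) n).trans ?_
          gcongr 4 * ?_
          apply Real.rpow_le_rpow_of_nonpos hj _ (by norm_num)
          push_cast; linarith
    _ = _ := by
        have : ((j : ℝ) + 1) ^ (-(1 / 2) : ℝ)
            = ((j : ℝ) + 1) ^ (α - 3 / 2) * ((j : ℝ) + 1) ^ (1 - α) := by
          rw [← Real.rpow_add hj]; congr 1; ring
        rw [add_mul, this]; ring

/-- Column sums of the fractional-integration kernel against the weight `(·+1)^(-1/2)`. -/
theorem sum_range_fractional_kernel_col_le {α : ℝ} (h0 : 0 ≤ α) (h1 : α < 1) (m : ℕ) :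
    ∑ j ∈ Finset.range (m + 1), ((m - j : ℕ) + 1 : ℝ) ^ (-α) * ((j : ℝ) + 1) ^ (-(1 / 2) : ℝ)
      ≤ (4 + 2 * (1 - α)⁻¹) * ((m : ℝ) + 1) ^ (1 / 2 - α) := by
  have hm : (0 : ℝ) < (m : ℝ) + 1 := by positivity
  -- One of m-j+1 and j+1 is at least (m+1)/2, and that factor may be replaced by twice the same
  -- power of m+1.
  have half : ∀ {x s : ℝ}, 0 ≤ s → s ≤ 1 → ((m : ℝ) + 1) / 2 ≤ x →
      x ^ (-s) ≤ 2 * ((m : ℝ) + 1) ^ (-s) := by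
    intro x s hs0 hs1 hx
    calc x ^ (-s) ≤ (((m : ℝ) + 1) / 2) ^ (-s) :=
          Real.rpow_le_rpow_of_nonpos (by positivity) hx (by linarith)
      _ = ((m : ℝ) + 1) ^ (-s) * 2 ^ s := by
          rw [Real.div_rpow hm.le (by norm_num), Real.rpow_neg (x := 2) (by norm_num),
            div_inv_eq_mul]
      _ ≤ ((m : ℝ) + 1) ^ (-s) * 2 ^ (1 : ℝ) := by
          gcongr
          norm_num
      _ = _ := by rw [Real.rpow_one]; ring
  have hterm : ∀ j ∈ Finset.range (m + 1),
      ((m - j : ℕ) + 1 : ℝ) ^ (-α) * ((j : ℝ) + 1) ^ (-(1 / 2) : ℝ)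
      ≤ 2 * ((m : ℝ) + 1) ^ (-α) * ((j : ℝ) + 1) ^ (-(1 / 2) : ℝ)
        + 2 * ((m : ℝ) + 1) ^ (-(1 / 2) : ℝ) * ((m - j : ℕ) + 1 : ℝ) ^ (-α) := by
    intro j hj
    have hjm : j ≤ m := by simpa [Nat.lt_succ_iff] using hj
    have hc : ((m - j : ℕ) : ℝ) = m - j := by push_cast [Nat.cast_sub hjm]; ring
    have p1 : 0 ≤ ((m - j : ℕ) + 1 : ℝ) ^ (-α) := by positivity
    have p2 : 0 ≤ ((j : ℝ) + 1) ^ (-(1 / 2) : ℝ) := by positivity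
    have p3 : 0 ≤ ((m : ℝ) + 1) ^ (-α) := by positivity
    have p4 : 0 ≤ ((m : ℝ) + 1) ^ (-(1 / 2) : ℝ) := by positivity
    rcases le_total (((m : ℝ) + 1) / 2) ((m - j : ℕ) + 1 : ℝ) with h | h
    · have := half h0 h1.le h
      have := mul_le_mul_of_nonneg_right this p2
      nlinarith [mul_nonneg p4 p1]
    · have h' : ((m : ℝ) + 1) / 2 ≤ (j : ℝ) + 1 := by rw [hc] at h; linarith
      have := half (s := 1 / 2) (by norm_num) (by norm_num) h'
      have := mul_le_mul_of_nonneg_right this p1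
      nlinarith [mul_nonneg p3 p2]
  refine (Finset.sum_le_sum hterm).trans ?_
  rw [Finset.sum_add_distrib, ← Finset.mul_sum, ← Finset.mul_sum]
  have s1 := sum_range_rpow_neg_le (s := 1 / 2) (by norm_num) (by norm_num) (m + 1)
  have s2 := sum_range_rpow_neg_le h0 h1 (m + 1)
  rw [← Finset.sum_range_reflect] at s2
  simp only [Nat.add_sub_cancel] at s2
  push_cast at s1 s2
  calc _ ≤ 2 * ((m : ℝ) + 1) ^ (-α) * ((1 - 1 / 2)⁻¹ * ((m : ℝ) + 1) ^ (1 - 1 / 2 : ℝ))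
        + 2 * ((m : ℝ) + 1) ^ (-(1 / 2) : ℝ) * ((1 - α)⁻¹ * ((m : ℝ) + 1) ^ (1 - α)) := by
        gcongr
    _ = 4 * (((m : ℝ) + 1) ^ (-α) * ((m : ℝ) + 1) ^ (1 - 1 / 2 : ℝ))
        + 2 * (1 - α)⁻¹ * (((m : ℝ) + 1) ^ (-(1 / 2) : ℝ) * ((m : ℝ) + 1) ^ (1 - α)) := by
        ring
    _ = _ := by
        rw [← Real.rpow_add hm, ← Real.rpow_add hm]
        ring_nf

/-! ### Defect form, and square summability implies convergence -/

section DefectForm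

variable {H : Type*} [NormedAddCommGroup H] [InnerProductSpace ℝ H]

/-- The norm `‖(1 - P⋆P)^{1/2} x‖` of the defect of a contraction `P` at `x`. -/
noncomputable def defect (P : H →L[ℝ] H) (x : H) : ℝ := √(‖x‖ ^ 2 - ‖P x‖ ^ 2)

theorem contraction_norm_apply_le {P : H →L[ℝ] H} (hP : ‖P‖ ≤ 1) (x : H) : ‖P x‖ ≤ ‖x‖ := by
  simpa using P.le_of_opNorm_le hP x

theorem contraction_norm_pow_le {P : H →L[ℝ] H} (hP : ‖P‖ ≤ 1) (n : ℕ) : ‖P ^ n‖ ≤ 1 := by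
  induction n with
  | zero => exact ContinuousLinearMap.norm_id_le
  | succ n ih =>
    rw [pow_succ]
    exact (norm_mul_le _ _).trans (mul_le_one₀ ih (norm_nonneg _) hP)

theorem contraction_antitone_norm_pow_apply {P : H →L[ℝ] H} (hP : ‖P‖ ≤ 1) (x : H) :
    Antitone fun n : ℕ => ‖(P ^ n) x‖ := by
  refine antitone_nat_of_succ_le fun n => ?_
  rw [pow_succ']
  exact contraction_norm_apply_le hP _

theorem defect_nonneg (P : H →L[ℝ] H) (x : H) : 0 ≤ defect P x := Real.sqrt_nonneg _

theorem defect_sq {P : H →L[ℝ] H} (hP : ‖P‖ ≤ 1) (x : H) :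
    defect P x ^ 2 = ‖x‖ ^ 2 - ‖P x‖ ^ 2 := by
  apply Real.sq_sqrt
  have := contraction_norm_apply_le hP x
  have := norm_nonneg (P x)
  nlinarith

theorem defect_smul {P : H →L[ℝ] H} {c : ℝ} (hc : 0 ≤ c) (x : H) :
    defect P (c • x) = c * defect P x := by
  rw [defect, defect, map_smul, norm_smul, norm_smul, Real.norm_of_nonneg hc,
    show (c * ‖x‖) ^ 2 - (c * ‖P x‖) ^ 2 = c ^ 2 * (‖x‖ ^ 2 - ‖P x‖ ^ 2) by ring,
    Real.sqrt_mul (sq_nonneg c), Real.sqrt_sq hc]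

/-- The form ⟨x, y⟩ - ⟨Px, Py⟩ is positive semidefinite because P is a contraction; Cauchy–Schwarz
for it gives the triangle inequality without any operator square root. -/
theorem defect_add_le {P : H →L[ℝ] H} (hP : ‖P‖ ≤ 1) (x y : H) :
    defect P (x + y) ≤ defect P x + defect P y := by
  let B : LinearMap.BilinForm ℝ H :=
    innerₗ H - (innerₗ H).compl₁₂ (P : H →ₗ[ℝ] H) (P : H →ₗ[ℝ] H)
  have hB : ∀ x y, B x y = inner ℝ x y - inner ℝ (P x) (P y) := fun x y => by simp [B]
  have hBx : ∀ x, B x x = defect P x ^ 2 := fun x => by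
    rw [hB, defect_sq hP, real_inner_self_eq_norm_sq, real_inner_self_eq_norm_sq]
  have hcs := B.apply_mul_apply_le_of_forall_zero_le (fun x => by rw [hBx]; positivity) x y
  have hsymm : B y x = B x y := by rw [hB, hB, real_inner_comm, real_inner_comm (P x)]
  rw [hsymm, hBx, hBx] at hcs
  have hx := defect_nonneg P x
  have hy := defect_nonneg P y
  have hxy : B x y ≤ defect P x * defect P y := by
    refine abs_le_of_sq_le_sq' ?_ (by positivity) |>.2
    nlinarith
  have hsum : defect P (x + y) ^ 2 = defect P x ^ 2 + 2 * B x y + defect P y ^ 2 := by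
    rw [← hBx, ← hBx, ← hBx]
    simp only [map_add, LinearMap.add_apply, hsymm]
    ring
  refine abs_le_of_sq_le_sq' ?_ (by positivity) |>.2
  nlinarith

theorem defect_sum_smul_le {ι : Type*} {P : H →L[ℝ] H} (hP : ‖P‖ ≤ 1) (s : Finset ι) (c : ι → ℝ)
    (hc : ∀ i, 0 ≤ c i) (z : ι → H) :
    defect P (∑ i ∈ s, c i • z i) ≤ ∑ i ∈ s, c i * defect P (z i) := by
  classical
  induction s using Finset.induction_on with
  | empty => simp [defect]
  | insert i s hi ih =>
    rw [Finset.sum_insert hi, Finset.sum_insert hi]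
    refine (defect_add_le hP _ _).trans ?_
    rw [defect_smul (hc i)]
    gcongr

theorem sum_Ico_defect_pow_sq {P : H →L[ℝ] H} (hP : ‖P‖ ≤ 1) (x : H) {M N : ℕ} (h : M ≤ N) :
    ∑ j ∈ Finset.Ico M N, defect P ((P ^ j) x) ^ 2 = ‖(P ^ M) x‖ ^ 2 - ‖(P ^ N) x‖ ^ 2 := by
  induction N, h using Nat.le_induction with
  | base => simp
  | succ n h ih =>
    rw [Finset.sum_Ico_succ_top h, ih, defect_sq hP, pow_succ' P n]
    simp

variable {α : ℝ} {P : H →L[ℝ] H}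

/-- The factor (m+1)^(α-1) makes the kernel homogeneous of degree -1, the critical degree for ℓ², so
the Schur test works with weight (·+1)^(-1/2) on both sides and a constant independent of J, M, L.
-/
theorem sum_sq_fractional_kernel_le (h0 : 0 ≤ α) (h1 : α < 1) (J M L : ℕ) (e : ℕ → ℝ) :
    ∑ j ∈ Finset.range J, (∑ m ∈ Finset.Ico M L,
      (if j ≤ m then ((m - j : ℕ) + 1 : ℝ) ^ (-α) * ((m : ℝ) + 1) ^ (α - 1) else 0) * e m) ^ 2
    ≤ ((1 - α)⁻¹ + 4) * (4 + 2 * (1 - α)⁻¹) * ∑ m ∈ Finset.Ico M L, e m ^ 2 := by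
  have hα : 0 < (1 - α)⁻¹ := inv_pos.2 (by linarith)
  apply schur_test (Finset.range J) (Finset.Ico M L) _ (fun m => ((m : ℝ) + 1) ^ (-(1 / 2) : ℝ))
    (fun j => ((j : ℝ) + 1) ^ (-(1 / 2) : ℝ))
  · intro j _ m _
    split_ifs <;> positivity
  · intro m _
    positivity
  · positivity
  · intro j _
    have hm : ∀ m : ℕ, 0 < (m : ℝ) + 1 := fun m => by positivity
    calc _ ≤ ∑ m ∈ Finset.Ico j L, ((m - j : ℕ) + 1 : ℝ) ^ (-α) * ((m : ℝ) + 1) ^ (α - 3 / 2) := by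
          rw [← Finset.sum_filter_add_sum_filter_not (Finset.Ico M L) (fun m => j ≤ m)]
          rw [Finset.sum_eq_zero (s := Finset.filter (fun m => ¬ j ≤ m) _), add_zero]
          · refine le_trans (le_of_eq ?_) (Finset.sum_le_sum_of_subset_of_nonneg
              (s := Finset.filter (fun m => j ≤ m) (Finset.Ico M L)) ?_ ?_)
            · refine Finset.sum_congr rfl fun m hmem => ?_
              rw [if_pos (Finset.mem_filter.1 hmem).2, mul_assoc, ← Real.rpow_add (hm m)]
              congr 2; ring
            · intro m hmem
              simp only [Finset.mem_filter, Finset.mem_Ico] at *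
              omega
            · intro m _ _; positivity
          · intro m hmem
            rw [if_neg (Finset.mem_filter.1 hmem).2, zero_mul]
      _ = ∑ i ∈ Finset.range (L - j), ((i : ℝ) + 1) ^ (-α) * ((i : ℝ) + j + 1) ^ (α - 3 / 2) := by
          rw [Finset.sum_Ico_eq_sum_range]
          refine Finset.sum_congr rfl fun i _ => ?_
          rw [Nat.add_sub_cancel_left]
          push_cast
          rw [add_comm (j : ℝ) i]
      _ ≤ _ := sum_range_fractional_kernel_row_le h0 h1 j _
  · intro m _
    have hm : 0 < (m : ℝ) + 1 := by positivity
    calc _ ≤ ∑ j ∈ Finset.range (m + 1), ((m : ℝ) + 1) ^ (α - 1) *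
            (((m - j : ℕ) + 1 : ℝ) ^ (-α) * ((j : ℝ) + 1) ^ (-(1 / 2) : ℝ)) := by
          rw [← Finset.sum_filter_add_sum_filter_not (Finset.range J) (fun j => j ≤ m)]
          rw [Finset.sum_eq_zero (s := Finset.filter (fun j => ¬ j ≤ m) _), add_zero]
          · refine le_trans (le_of_eq ?_) (Finset.sum_le_sum_of_subset_of_nonneg
              (s := Finset.filter (fun j => j ≤ m) (Finset.range J)) ?_ ?_)
            · refine Finset.sum_congr rfl fun j hmem => ?_
              rw [if_pos (Finset.mem_filter.1 hmem).2]
              ring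
            · intro j hmem
              simp only [Finset.mem_filter, Finset.mem_range] at *
              omega
            · intro m _ _; positivity
          · intro j hmem
            rw [if_neg (Finset.mem_filter.1 hmem).2, zero_mul]
      _ ≤ ((m : ℝ) + 1) ^ (α - 1) * ((4 + 2 * (1 - α)⁻¹) * ((m : ℝ) + 1) ^ (1 / 2 - α)) := by
          rw [← Finset.mul_sum]
          gcongr
          exact sum_range_fractional_kernel_col_le h0 h1 m
      _ = _ := by
          rw [mul_left_comm, ← Real.rpow_add hm]
          congr 2; ring

/-- With m = n + j, the defect of P^j x is at most Σ_{m≥M+j} (m-j+1)^(-α) d(P^m f). Only indices m ≥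
M enter, so late blocks get small bounds. -/
theorem norm_sq_sum_Ico_le (hP : ‖P‖ ≤ 1) (h0 : 0 ≤ α) (h1 : α < 1) (f : H) (M N J : ℕ) :
    ‖∑ n ∈ Finset.Ico M N, ((n : ℝ) + 1) ^ (-α) • (P ^ n) f‖ ^ 2
      ≤ ((1 - α)⁻¹ + 4) * (4 + 2 * (1 - α)⁻¹) * ∑ m ∈ Finset.Ico M (N + J),
          ((m : ℝ) + 1) ^ (2 - 2 * α) * defect P ((P ^ m) f) ^ 2
        + ‖(P ^ J) (∑ n ∈ Finset.Ico M N, ((n : ℝ) + 1) ^ (-α) • (P ^ n) f)‖ ^ 2 := by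
  set x := ∑ n ∈ Finset.Ico M N, ((n : ℝ) + 1) ^ (-α) • (P ^ n) f with hx
  have key := sum_Ico_defect_pow_sq hP x (Nat.zero_le J)
  rw [← Finset.range_eq_Ico] at key
  have hid : ‖x‖ ^ 2 = ∑ j ∈ Finset.range J, defect P ((P ^ j) x) ^ 2 + ‖(P ^ J) x‖ ^ 2 := by
    rw [key]; simp
  rw [hid]
  gcongr
  have hs := sum_sq_fractional_kernel_le h0 h1 J M (N + J)
    (fun m => ((m : ℝ) + 1) ^ (1 - α) * defect P ((P ^ m) f))
  have he : ∀ m : ℕ, (((m : ℝ) + 1) ^ (1 - α) * defect P ((P ^ m) f)) ^ 2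
      = ((m : ℝ) + 1) ^ (2 - 2 * α) * defect P ((P ^ m) f) ^ 2 := by
    intro m
    have hm : 0 < (m : ℝ) + 1 := by positivity
    rw [mul_pow, ← Real.rpow_natCast, ← Real.rpow_mul hm.le]
    congr 2; push_cast; ring
  simp only [he] at hs
  refine le_trans (Finset.sum_le_sum fun j hj => ?_) hs
  have hjJ := Finset.mem_range.1 hj
  have hPj : (P ^ j) x = ∑ n ∈ Finset.Ico M N, ((n : ℝ) + 1) ^ (-α) • (P ^ (n + j)) f := by
    rw [hx, map_sum]
    refine Finset.sum_congr rfl fun n _ => ?_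
    rw [map_smul, add_comm n j, pow_add]; rfl
  have hd : defect P ((P ^ j) x)
      ≤ ∑ n ∈ Finset.Ico M N, ((n : ℝ) + 1) ^ (-α) * defect P ((P ^ (n + j)) f) := by
    rw [hPj]
    exact defect_sum_smul_le hP _ (fun n : ℕ => ((n : ℝ) + 1) ^ (-α)) (fun n => by positivity) _
  have hshift : ∑ n ∈ Finset.Ico M N, ((n : ℝ) + 1) ^ (-α) * defect P ((P ^ (n + j)) f)
      = ∑ m ∈ Finset.Ico (M + j) (N + j),
        ((m - j : ℕ) + 1 : ℝ) ^ (-α) * defect P ((P ^ m) f) := by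
    rw [← Finset.sum_Ico_add' _ M N j]
    simp
  have hnn : 0 ≤ defect P ((P ^ j) x) := defect_nonneg _ _
  gcongr
  rw [hshift] at hd
  refine hd.trans ?_
  refine le_trans (le_of_eq ?_) (Finset.sum_le_sum_of_subset_of_nonneg
    (s := Finset.Ico (M + j) (N + j)) ?_ ?_)
  · refine Finset.sum_congr rfl fun m hmem => ?_
    have hm : 0 < (m : ℝ) + 1 := by positivity
    rw [if_pos (by rw [Finset.mem_Ico] at hmem; omega)]
    have : ((m : ℝ) + 1) ^ (α - 1) * ((m : ℝ) + 1) ^ (1 - α) = 1 := by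
      rw [← Real.rpow_add hm]; simp
    linear_combination -((m - j : ℕ) + 1 : ℝ) ^ (-α) * defect P ((P ^ m) f) * this
  · intro m hmem
    simp only [Finset.mem_Ico] at *
    omega
  · intro m _ _
    have := defect_nonneg P ((P ^ m) f)
    split_ifs <;> positivity

/-- Abel summation: (m+1)^(2-2α) ≤ 2 Σ_{n≤m} (n+1)^(1-2α), and after exchanging the sums the squared
defects from n on telescope to at most ‖Pⁿf‖². -/
theorem summable_rpow_mul_defect_sq (hP : ‖P‖ ≤ 1) (h0 : 0 ≤ α) (h1 : α < 1) {f : H}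
    (hf : Summable fun n : ℕ => ((n : ℝ) + 1) ^ (1 - 2 * α) * ‖(P ^ n) f‖ ^ 2) :
    Summable fun m : ℕ => ((m : ℝ) + 1) ^ (2 - 2 * α) * defect P ((P ^ m) f) ^ 2 := by
  refine summable_of_sum_range_le
    (c := 2 * ∑' n : ℕ, ((n : ℝ) + 1) ^ (1 - 2 * α) * ‖(P ^ n) f‖ ^ 2) (fun n => by positivity) ?_
  intro L
  calc ∑ m ∈ Finset.range L, ((m : ℝ) + 1) ^ (2 - 2 * α) * defect P ((P ^ m) f) ^ 2
      ≤ ∑ m ∈ Finset.range L, ∑ n ∈ Finset.range (m + 1),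
          2 * ((n : ℝ) + 1) ^ (1 - 2 * α) * defect P ((P ^ m) f) ^ 2 := by
        refine Finset.sum_le_sum fun m _ => ?_
        rw [← Finset.sum_mul, ← Finset.mul_sum]
        gcongr
        have := rpow_le_two_mul_sum_range (γ := 2 - 2 * α) (by linarith) (by linarith) (m + 1)
        rw [show 2 - 2 * α - 1 = 1 - 2 * α by ring] at this
        push_cast at this
        exact this
    _ = ∑ n ∈ Finset.range L, ∑ m ∈ Finset.Ico n L,
          2 * ((n : ℝ) + 1) ^ (1 - 2 * α) * defect P ((P ^ m) f) ^ 2 := by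
        apply Finset.sum_comm'
        intro m n
        simp only [Finset.mem_range, Finset.mem_Ico]
        omega
    _ ≤ ∑ n ∈ Finset.range L, 2 * (((n : ℝ) + 1) ^ (1 - 2 * α) * ‖(P ^ n) f‖ ^ 2) := by
        refine Finset.sum_le_sum fun n hn => ?_
        rw [← Finset.mul_sum, sum_Ico_defect_pow_sq hP f (Finset.mem_range.1 hn).le, ← mul_assoc]
        gcongr
        linarith [sq_nonneg ‖(P ^ L) f‖]
    _ ≤ _ := by
        rw [← Finset.mul_sum]
        gcongr
        exact hf.sum_le_tsum _ fun n _ => by positivity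

/-- As ‖Pⁿf‖ decreases, n^(2-2α)‖Pⁿf‖² is at most twice the whole sum. -/
theorem tendsto_norm_pow_apply_zero_of_summable (hP : ‖P‖ ≤ 1) (h1 : α < 1) (h0 : 0 ≤ α) {f : H}
    (hf : Summable fun n : ℕ => ((n : ℝ) + 1) ^ (1 - 2 * α) * ‖(P ^ n) f‖ ^ 2) :
    Tendsto (fun n : ℕ => (P ^ n) f) atTop (𝓝 0) := by
  set S := ∑' n : ℕ, ((n : ℝ) + 1) ^ (1 - 2 * α) * ‖(P ^ n) f‖ ^ 2
  have hb : ∀ n : ℕ, 1 ≤ n → ‖(P ^ n) f‖ ^ 2 ≤ 2 * S * (n : ℝ) ^ (-(2 - 2 * α)) := by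
    intro n hn
    have hn' : (0 : ℝ) < n := by exact_mod_cast hn
    have hlow := rpow_le_two_mul_sum_range (γ := 2 - 2 * α) (by linarith) (by linarith) n
    rw [show 2 - 2 * α - 1 = 1 - 2 * α by ring] at hlow
    have hs : (∑ i ∈ Finset.range n, ((i : ℝ) + 1) ^ (1 - 2 * α)) * ‖(P ^ n) f‖ ^ 2 ≤ S := by
      rw [Finset.sum_mul]
      refine le_trans (Finset.sum_le_sum fun i hi => ?_)
        (hf.sum_le_tsum (Finset.range n) fun n _ => by positivity)
      gcongr
      exact contraction_antitone_norm_pow_apply hP f (Finset.mem_range.1 hi).le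
    rw [Real.rpow_neg hn'.le, ← div_eq_mul_inv, le_div_iff₀ (by positivity)]
    nlinarith [mul_le_mul_of_nonneg_left hlow (sq_nonneg ‖(P ^ n) f‖)]
  have hlim : Tendsto (fun n : ℕ => 2 * S * (n : ℝ) ^ (-(2 - 2 * α))) atTop (𝓝 0) := by
    have := ((tendsto_rpow_neg_atTop (y := 2 - 2 * α) (by linarith)).comp
      tendsto_natCast_atTop_atTop).const_mul (2 * S)
    simpa using this
  have hsq : Tendsto (fun n : ℕ => ‖(P ^ n) f‖ ^ 2) atTop (𝓝 0) := by
    refine squeeze_zero' (Eventually.of_forall fun n => by positivity) ?_ hlim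
    filter_upwards [eventually_ge_atTop 1] with n hn using hb n hn
  rw [tendsto_zero_iff_norm_tendsto_zero]
  have := hsq.sqrt
  simpa using this

theorem cauchySeq_of_summable (hP : ‖P‖ ≤ 1) (h0 : 0 ≤ α) (h1 : α < 1) {f : H}
    (hf : Summable fun n : ℕ => ((n : ℝ) + 1) ^ (1 - 2 * α) * ‖(P ^ n) f‖ ^ 2) :
    CauchySeq fun N : ℕ => ∑ n ∈ Finset.range N, ((n : ℝ) + 1) ^ (-α) • (P ^ n) f := by
  have hs := summable_rpow_mul_defect_sq hP h0 h1 hf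
  have hP0 := tendsto_norm_pow_apply_zero_of_summable hP h1 h0 hf
  set w : ℕ → ℝ := fun m => ((m : ℝ) + 1) ^ (2 - 2 * α) * defect P ((P ^ m) f) ^ 2 with hw
  have hw0 : ∀ m, 0 ≤ w m := fun m => by positivity
  set C := ((1 - α)⁻¹ + 4) * (4 + 2 * (1 - α)⁻¹) with hC
  have hα : 0 < (1 - α)⁻¹ := inv_pos.2 (by linarith)
  have hC0 : 0 ≤ C := by positivity
  -- Letting J → ∞ kills ‖P^J x‖, as x is a finite combination of the Pⁿf; the resulting bound is
  -- uniform in N.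
  have hbound : ∀ M N : ℕ, ‖∑ n ∈ Finset.Ico M N, ((n : ℝ) + 1) ^ (-α) • (P ^ n) f‖ ^ 2
      ≤ C * ∑' m, w (m + M) := by
    intro M N
    set x := ∑ n ∈ Finset.Ico M N, ((n : ℝ) + 1) ^ (-α) • (P ^ n) f with hx
    have hxJ : Tendsto (fun J : ℕ => C * ∑' m, w (m + M) + ‖(P ^ J) x‖ ^ 2) atTop
        (𝓝 (C * ∑' m, w (m + M) + ‖(0 : H)‖ ^ 2)) := by
      refine tendsto_const_nhds.add (Tendsto.pow (Tendsto.norm ?_) 2)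
      have : ∀ J : ℕ, (P ^ J) x
          = ∑ n ∈ Finset.Ico M N, ((n : ℝ) + 1) ^ (-α) • (P ^ n) ((P ^ J) f) := by
        intro J
        rw [hx, map_sum]
        refine Finset.sum_congr rfl fun n _ => ?_
        rw [map_smul, ← mul_apply_eq_comp, ← mul_apply_eq_comp,
          ← pow_add, ← pow_add, add_comm J n]
      simp only [this]
      rw [show (0 : H) = ∑ n ∈ Finset.Ico M N, ((n : ℝ) + 1) ^ (-α) • (P ^ n) (0 : H) by simp]
      refine tendsto_finsetSum _ fun n _ => Tendsto.const_smul ?_ _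
      exact ((P ^ n).continuous.tendsto 0).comp hP0
    rw [norm_zero, zero_pow two_ne_zero, add_zero] at hxJ
    refine ge_of_tendsto' hxJ fun J => (norm_sq_sum_Ico_le hP h0 h1 f M N J).trans ?_
    gcongr
    rw [Finset.sum_Ico_eq_sum_range]
    simp only [add_comm M]
    exact ((summable_nat_add_iff M).2 hs).sum_le_tsum _ fun n _ => hw0 _
  refine cauchySeq_of_le_tendsto_0 (fun M => √(C * ∑' m, w (m + M)) * 2) ?_ ?_
  · have haux : ∀ n M : ℕ, M ≤ n →
        dist (∑ i ∈ Finset.range n, ((i : ℝ) + 1) ^ (-α) • (P ^ i) f)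
          (∑ i ∈ Finset.range M, ((i : ℝ) + 1) ^ (-α) • (P ^ i) f) ≤ √(C * ∑' m, w (m + M)) := by
      intro n M hn
      rw [dist_eq_norm, ← Finset.sum_Ico_eq_sub _ hn]
      exact Real.le_sqrt_of_sq_le (hbound M n)
    intro n m N hn hm
    calc _ ≤ _ := dist_triangle_right _ _
            (∑ i ∈ Finset.range N, ((i : ℝ) + 1) ^ (-α) • (P ^ i) f)
      _ ≤ _ := by rw [mul_two]; exact add_le_add (haux n N hn) (haux m N hm)
  · have := (((tendsto_sum_nat_add w).const_mul C).sqrt).mul_const 2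
    simpa using this

end DefectForm

/-! ### Kaluza's theorem and the reciprocal of Σ (n+1)^(-α) zⁿ -/

section Kaluza

/-- Coefficients of the reciprocal of the power series `∑ aₙ zⁿ`. -/
noncomputable def recipCoeff (a : ℕ → ℝ) (n : ℕ) : ℝ := PowerSeries.coeff n (PowerSeries.mk a)⁻¹

/-- Partial sums of the coefficients of the reciprocal of the power series `∑ aₙ zⁿ`. -/
noncomputable def recipPartial (a : ℕ → ℝ) (n : ℕ) : ℝ :=
  ∑ k ∈ Finset.range (n + 1), recipCoeff a k

variable {a : ℕ → ℝ}

theorem recipPartial_succ (a : ℕ → ℝ) (n : ℕ) :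
    recipPartial a (n + 1) = recipPartial a n + recipCoeff a (n + 1) :=
  Finset.sum_range_succ _ _

theorem inv_mk_mul_mk (h0 : a 0 = 1) : (PowerSeries.mk a)⁻¹ * PowerSeries.mk a = 1 := by
  apply PowerSeries.inv_mul_cancel
  rw [← PowerSeries.coeff_zero_eq_constantCoeff_apply, PowerSeries.coeff_mk, h0]
  exact one_ne_zero

theorem sum_recipCoeff_mul (h0 : a 0 = 1) (n : ℕ) :
    ∑ k ∈ Finset.range (n + 1), recipCoeff a k * a (n - k) = if n = 0 then 1 else 0 := by
  have h := congrArg (PowerSeries.coeff n) (inv_mk_mul_mk h0)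
  rw [PowerSeries.coeff_mul, PowerSeries.coeff_one,
    Finset.Nat.sum_antidiagonal_eq_sum_range_succ_mk] at h
  simpa [recipCoeff] using h

theorem recipCoeff_zero (h0 : a 0 = 1) : recipCoeff a 0 = 1 := by
  simpa [h0] using sum_recipCoeff_mul h0 0

theorem sum_recipPartial_mul (h0 : a 0 = 1) (n : ℕ) :
    ∑ k ∈ Finset.range (n + 1), recipPartial a k * a (n - k) = 1 := by
  have hB : PowerSeries.mk (recipPartial a) = PowerSeries.mk (fun _ => (1 : ℝ)) * (PowerSeries.mk a)⁻¹ := by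
    ext m
    rw [mul_comm, PowerSeries.coeff_mul, Finset.Nat.sum_antidiagonal_eq_sum_range_succ_mk]
    simp [recipPartial, recipCoeff]
  have h : PowerSeries.mk (recipPartial a) * PowerSeries.mk a = PowerSeries.mk (fun _ => (1 : ℝ)) := by
    rw [hB, mul_assoc, inv_mk_mul_mk h0, mul_one]
  have h' := congrArg (PowerSeries.coeff n) h
  rw [PowerSeries.coeff_mul, Finset.Nat.sum_antidiagonal_eq_sum_range_succ_mk] at h'
  simpa using h'

/-- Kaluza's theorem: the reciprocal of a power series with positive log-convex coefficients has
nonpositive coefficients, apart from the constant one. -/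
theorem recipCoeff_succ_nonpos (h0 : a 0 = 1) (hpos : ∀ n, 0 < a n)
    (hlog : ∀ m n, m ≤ n → a n * a (m + 1) ≤ a (n + 1) * a m) (n : ℕ) :
    recipCoeff a (n + 1) ≤ 0 := by
  induction n using Nat.strong_induction_on with
  | _ n ih =>
    have h1 := sum_recipCoeff_mul h0 (n + 1)
    rw [Finset.sum_range_succ, Nat.sub_self, h0, mul_one, if_neg (Nat.succ_ne_zero n)] at h1
    rcases Nat.eq_zero_or_pos n with rfl | hn
    · have := hpos 1
      simp only [zero_add, Finset.sum_range_one, recipCoeff_zero h0, one_mul, Nat.sub_zero] at h1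
      simp only [zero_add]
      linarith
    · have h2 := sum_recipCoeff_mul h0 n
      rw [if_neg hn.ne'] at h2
      -- Combine a (n+1) times the identity at n with -a n times the one at n+1: the k = 0 terms
      -- cancel, log-convexity and induction sign the others, and what is left over is a n times the
      -- new coefficient.
      have h3 : ∑ k ∈ Finset.range (n + 1),
          recipCoeff a k * (a (n + 1) * a (n - k) - a n * a (n + 1 - k)) ≤ 0 := by
        refine Finset.sum_nonpos fun k hk => ?_
        have hk' := Finset.mem_range.1 hk
        rcases Nat.eq_zero_or_pos k with rfl | hk0
        · apply le_of_eq
          simp only [Nat.sub_zero]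
          ring
        · have hb : recipCoeff a k ≤ 0 := by
            have := ih (k - 1) (by omega)
            rwa [Nat.sub_add_cancel hk0] at this
          have := hlog (n - k) n (Nat.sub_le _ _)
          rw [show n - k + 1 = n + 1 - k by omega] at this
          exact mul_nonpos_of_nonpos_of_nonneg hb (by linarith)
      have h4 : ∑ k ∈ Finset.range (n + 1),
          recipCoeff a k * (a (n + 1) * a (n - k) - a n * a (n + 1 - k))
          = a (n + 1) * ∑ k ∈ Finset.range (n + 1), recipCoeff a k * a (n - k)
            - a n * ∑ k ∈ Finset.range (n + 1), recipCoeff a k * a (n + 1 - k) := by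
        rw [Finset.mul_sum, Finset.mul_sum, ← Finset.sum_sub_distrib]
        refine Finset.sum_congr rfl fun k _ => ?_
        ring
      rw [h4, h2] at h3
      have h5 : a n * recipCoeff a (n + 1) ≤ 0 := by
        rw [eq_neg_of_add_eq_zero_right h1]; linarith
      exact nonpos_of_mul_nonpos_right h5 (hpos n)

/-- For k ≥ 1 the coefficient is nonpositive, so lowering a (n-k) to a n increases the term. Thus Bₙ
aₙ dominates the convolution identity, whose value is 0 or 1. -/
theorem recipPartial_nonneg (h0 : a 0 = 1) (hpos : ∀ n, 0 < a n) (hanti : Antitone a)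
    (hlog : ∀ m n, m ≤ n → a n * a (m + 1) ≤ a (n + 1) * a m) (n : ℕ) :
    0 ≤ recipPartial a n := by
  have h1 : ∑ k ∈ Finset.range (n + 1), recipCoeff a k * a (n - k)
      ≤ ∑ k ∈ Finset.range (n + 1), recipCoeff a k * a n := by
    refine Finset.sum_le_sum fun k _ => ?_
    rcases Nat.eq_zero_or_pos k with rfl | hk
    · simp
    · have hb := recipCoeff_succ_nonpos h0 hpos hlog (k - 1)
      rw [Nat.sub_add_cancel hk] at hb
      exact mul_le_mul_of_nonpos_left (hanti (Nat.sub_le n k)) hb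
  rw [sum_recipCoeff_mul h0, ← Finset.sum_mul] at h1
  have h2 : 0 ≤ recipPartial a n * a n := le_trans (by split_ifs <;> norm_num) h1
  exact nonneg_of_mul_nonneg_left h2 (hpos n)

theorem recipPartial_antitone (h0 : a 0 = 1) (hpos : ∀ n, 0 < a n)
    (hlog : ∀ m n, m ≤ n → a n * a (m + 1) ≤ a (n + 1) * a m) : Antitone (recipPartial a) := by
  refine antitone_nat_of_succ_le fun n => ?_
  rw [recipPartial_succ]
  linarith [recipCoeff_succ_nonpos h0 hpos hlog n]

theorem sum_recipPartial_le (h0 : a 0 = 1) (hpos : ∀ n, 0 < a n) (hanti : Antitone a)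
    (hlog : ∀ m n, m ≤ n → a n * a (m + 1) ≤ a (n + 1) * a m) (n : ℕ) :
    ∑ k ∈ Finset.range (n + 1), recipPartial a k ≤ (a n)⁻¹ := by
  rw [← mul_one (a n)⁻¹, ← sum_recipPartial_mul h0 n, inv_mul_eq_div, le_div_iff₀ (hpos n),
    Finset.sum_mul]
  refine Finset.sum_le_sum fun k _ => ?_
  exact mul_le_mul_of_nonneg_left (hanti (Nat.sub_le n k))
    (recipPartial_nonneg h0 hpos hanti hlog k)

theorem succ_mul_recipPartial_le (h0 : a 0 = 1) (hpos : ∀ n, 0 < a n) (hanti : Antitone a)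
    (hlog : ∀ m n, m ≤ n → a n * a (m + 1) ≤ a (n + 1) * a m) (n : ℕ) :
    ((n : ℝ) + 1) * recipPartial a n ≤ (a n)⁻¹ := by
  refine le_trans ?_ (sum_recipPartial_le h0 hpos hanti hlog n)
  have : ∑ _k ∈ Finset.range (n + 1), recipPartial a n = ((n : ℝ) + 1) * recipPartial a n := by
    simp
  rw [← this]
  refine Finset.sum_le_sum fun k hk => ?_
  exact recipPartial_antitone h0 hpos hlog (Nat.lt_succ_iff.1 (Finset.mem_range.1 hk))

variable {α : ℝ}

theorem rpow_neg_zero_eq_one : (((0 : ℕ) : ℝ) + 1) ^ (-α) = 1 := by simp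

theorem rpow_neg_antitone (h0 : 0 ≤ α) : Antitone fun n : ℕ => ((n : ℝ) + 1) ^ (-α) := by
  intro m n h
  apply Real.rpow_le_rpow_of_nonpos (by positivity) _ (by linarith)
  have : (m : ℝ) ≤ n := by exact_mod_cast h
  linarith

theorem rpow_neg_logConvex (h0 : 0 ≤ α) (m n : ℕ) (h : m ≤ n) :
    ((n : ℝ) + 1) ^ (-α) * (((m + 1 : ℕ) : ℝ) + 1) ^ (-α)
      ≤ (((n + 1 : ℕ) : ℝ) + 1) ^ (-α) * ((m : ℝ) + 1) ^ (-α) := by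
  rw [← Real.mul_rpow (by positivity) (by positivity),
    ← Real.mul_rpow (by positivity) (by positivity)]
  apply Real.rpow_le_rpow_of_nonpos (by positivity) _ (by linarith)
  have : (m : ℝ) ≤ n := by exact_mod_cast h
  push_cast
  nlinarith

/-- The partial sums of the coefficients of `(∑ (n+1)^(-α) zⁿ)⁻¹`. -/
noncomputable def fracPartial (α : ℝ) : ℕ → ℝ := recipPartial fun n : ℕ => ((n : ℝ) + 1) ^ (-α)

theorem fracPartial_nonneg (h0 : 0 ≤ α) (n : ℕ) : 0 ≤ fracPartial α n :=
  recipPartial_nonneg rpow_neg_zero_eq_one (fun n => by positivity) (rpow_neg_antitone h0)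
    (rpow_neg_logConvex h0) n

theorem fracPartial_antitone (h0 : 0 ≤ α) : Antitone (fracPartial α) :=
  recipPartial_antitone rpow_neg_zero_eq_one (fun n => by positivity) (rpow_neg_logConvex h0)

theorem sum_fracPartial_le (h0 : 0 ≤ α) (n : ℕ) :
    ∑ k ∈ Finset.range n, fracPartial α k ≤ (n : ℝ) ^ α := by
  rcases n with _ | n
  · simp only [Finset.range_zero, Finset.sum_empty]; positivity
  have := sum_recipPartial_le (a := fun n : ℕ => ((n : ℝ) + 1) ^ (-α)) rpow_neg_zero_eq_one
    (fun n => by positivity) (rpow_neg_antitone h0) (rpow_neg_logConvex h0) n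
  simp only [Real.rpow_neg (show (0 : ℝ) ≤ (n : ℝ) + 1 by positivity), inv_inv] at this
  push_cast
  exact this

theorem fracPartial_le (h0 : 0 ≤ α) (n : ℕ) : fracPartial α n ≤ ((n : ℝ) + 1) ^ (α - 1) := by
  have hn : (0 : ℝ) < (n : ℝ) + 1 := by positivity
  have := succ_mul_recipPartial_le (a := fun n : ℕ => ((n : ℝ) + 1) ^ (-α)) rpow_neg_zero_eq_one
    (fun n => by positivity) (rpow_neg_antitone h0) (rpow_neg_logConvex h0) n
  simp only [Real.rpow_neg hn.le, inv_inv] at this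
  rw [Real.rpow_sub_one hn.ne', le_div_iff₀' hn]
  simpa only [fracPartial, Real.rpow_neg hn.le] using this

theorem fracPartial_le_of_pos (h0 : 0 ≤ α) (h1 : α < 1) {n : ℕ} (hn : 1 ≤ n) :
    fracPartial α n ≤ (n : ℝ) ^ (α - 1) := by
  refine (fracPartial_le h0 n).trans ?_
  have : (0 : ℝ) < n := by exact_mod_cast hn
  exact Real.rpow_le_rpow_of_nonpos this (by linarith) (by linarith)

end Kaluza

/-! ### Resolvents of 1 - P and their square-summable differences -/

section Resolvent

variable {H : Type*} [NormedAddCommGroup H] [InnerProductSpace ℝ H] {P : H →L[ℝ] H}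

/-- The resolvent `(1 + t(1 - P))⁻¹`. -/
noncomputable def abelResolvent (P : H →L[ℝ] H) (t : ℝ) : H →L[ℝ] H :=
  Ring.inverse (1 + t • (1 - P))

/-- Neumann series for 1 + t(1-P) = (1+t)(1 - (t/(1+t))P). -/
theorem isUnit_one_add_smul_one_sub [CompleteSpace H] (hP : ‖P‖ ≤ 1) {t : ℝ} (ht : 0 ≤ t) :
    IsUnit (1 + t • (1 - P)) := by
  have h1 : (0 : ℝ) < 1 + t := by linarith
  have hn : ‖(t / (1 + t)) • P‖ < 1 := by
    rw [norm_smul, Real.norm_of_nonneg (by positivity)]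
    calc t / (1 + t) * ‖P‖ ≤ t / (1 + t) * 1 := by gcongr
      _ < 1 := by rw [mul_one, div_lt_one h1]; linarith
  have he : 1 + t • (1 - P) = (1 + t) • (1 - (t / (1 + t)) • P) := by
    rw [smul_sub, smul_sub, smul_smul, mul_div_cancel₀ _ h1.ne', add_smul, one_smul]
    abel
  rw [he]
  exact (isUnit_one_sub_of_norm_lt_one hn).smul (Units.mk0 (1 + t) h1.ne')

theorem mul_abelResolvent [CompleteSpace H] (hP : ‖P‖ ≤ 1) {t : ℝ} (ht : 0 ≤ t) :
    (1 + t • (1 - P)) * abelResolvent P t = 1 :=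
  Ring.mul_inverse_cancel _ (isUnit_one_add_smul_one_sub hP ht)

theorem commute_abelResolvent {T : H →L[ℝ] H} (h : Commute T P) (t : ℝ) :
    Commute T (abelResolvent P t) := by
  have hc : Commute T (1 + t • (1 - P)) :=
    (Commute.one_right T).add_right (((Commute.one_right T).sub_right h).smul_right t)
  rw [abelResolvent]
  by_cases hu : IsUnit (1 + t • (1 - P))
  · obtain ⟨u, hu⟩ := hu
    rw [← hu] at hc ⊢
    rw [Ring.inverse_unit]
    exact hc.units_inv_right
  · rw [Ring.inverse_non_unit _ hu]
    exact Commute.zero_right T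

theorem norm_abelResolvent_le [CompleteSpace H] (hP : ‖P‖ ≤ 1) {t : ℝ} (ht : 0 ≤ t) :
    ‖abelResolvent P t‖ ≤ 1 := by
  refine ContinuousLinearMap.opNorm_le_bound _ zero_le_one fun x => ?_
  set u := abelResolvent P t x with hu
  have hx : x = (1 + t) • u - t • P u := by
    have := congrArg (fun T : H →L[ℝ] H => T x) (mul_abelResolvent hP ht)
    simp only [mul_apply_eq_comp, one_apply_eq_self] at this
    rw [← this, ← hu]
    simp [smul_sub, add_smul]
    abel
  have h1 : ‖(1 + t) • u‖ ≤ ‖x‖ + ‖t • P u‖ := by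
    have : (1 + t) • u = x + t • P u := by rw [hx]; abel
    rw [this]
    exact norm_add_le _ _
  rw [norm_smul, norm_smul, Real.norm_of_nonneg ht, Real.norm_of_nonneg (by linarith)] at h1
  have := mul_le_mul_of_nonneg_left (contraction_norm_apply_le hP u) ht
  linarith

theorem one_sub_abelResolvent [CompleteSpace H] (hP : ‖P‖ ≤ 1) {t : ℝ} (ht : 0 ≤ t) :
    1 - abelResolvent P t = t • ((1 - P) * abelResolvent P t) := by
  rw [sub_eq_iff_eq_add', ← smul_mul_assoc, ← one_add_mul, mul_abelResolvent hP ht]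

/-- Accretivity of `1 - P` makes `‖(1 + t(1 - P))⁻¹ x‖` decrease in `t`, with quantitative gain. -/
theorem norm_sq_abelResolvent_sub_le [CompleteSpace H] (hP : ‖P‖ ≤ 1) {t : ℝ} (ht : 0 ≤ t)
    (x : H) :
    3 * ‖(abelResolvent P t - abelResolvent P (2 * t)) x‖ ^ 2
      ≤ ‖abelResolvent P t x‖ ^ 2 - ‖abelResolvent P (2 * t) x‖ ^ 2 := by
  have ht2 : 0 ≤ 2 * t := by linarith
  have hcomm : Commute (abelResolvent P t) (abelResolvent P (2 * t)) :=
    commute_abelResolvent (commute_abelResolvent (Commute.refl P) t).symm _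
  -- With v = w - Pw one has U_{2t}x = w + tv and U_t x = w + 2tv; the squared norms differ by 2t⟨w,
  -- v⟩ + 3t²‖v‖², whence the factor 3.
  set w := abelResolvent P t (abelResolvent P (2 * t) x) with hw
  have hu' : abelResolvent P (2 * t) x = w + t • (w - P w) := by
    have := congrArg (fun T : H →L[ℝ] H => T (abelResolvent P (2 * t) x)) (mul_abelResolvent hP ht)
    simpa using this.symm
  have hu : abelResolvent P t x = w + (2 * t) • (w - P w) := by
    have := congrArg (fun T : H →L[ℝ] H => T (abelResolvent P t x)) (mul_abelResolvent hP ht2)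
    have hw' : abelResolvent P (2 * t) (abelResolvent P t x) = w :=
      (congrArg (fun T : H →L[ℝ] H => T x) hcomm.eq).symm
    simp only [mul_apply_eq_comp, one_apply_eq_self, hw'] at this
    simpa using this.symm
  have hacc : 0 ≤ inner ℝ w (w - P w) := by
    rw [inner_sub_right, real_inner_self_eq_norm_sq]
    have h1 := real_inner_le_norm w (P w)
    have h2 := contraction_norm_apply_le hP w
    nlinarith [norm_nonneg w]
  rw [sub_apply, hu, hu']
  generalize w - P w = v at *
  have e : w + (2 * t) • v - (w + t • v) = t • v := by rw [two_mul, add_smul]; abel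
  rw [e, norm_add_sq_real, norm_add_sq_real, norm_smul, norm_smul, inner_smul_right,
    inner_smul_right, Real.norm_of_nonneg ht, Real.norm_of_nonneg ht2]
  nlinarith [mul_nonneg ht hacc]

theorem sum_norm_sq_abelResolvent_sub_le [CompleteSpace H] (hP : ‖P‖ ≤ 1) (K : ℕ) (x : H) :
    ∑ j ∈ Finset.range K, ‖(abelResolvent P (2 ^ j) - abelResolvent P (2 ^ (j + 1))) x‖ ^ 2
      ≤ ‖x‖ ^ 2 := by
  have h : 3 * ∑ j ∈ Finset.range K,
      ‖(abelResolvent P (2 ^ j) - abelResolvent P (2 ^ (j + 1))) x‖ ^ 2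
      ≤ ‖abelResolvent P (2 ^ 0) x‖ ^ 2 - ‖abelResolvent P (2 ^ K) x‖ ^ 2 := by
    rw [Finset.mul_sum, ← Finset.sum_range_sub' (fun j => ‖abelResolvent P (2 ^ j) x‖ ^ 2)]
    refine Finset.sum_le_sum fun j _ => ?_
    rw [pow_succ' (2 : ℝ)]
    exact norm_sq_abelResolvent_sub_le hP (by positivity) x
  have h0 : ‖abelResolvent P (2 ^ 0) x‖ ≤ ‖x‖ := by
    have := (abelResolvent P (2 ^ 0)).le_of_opNorm_le
      (norm_abelResolvent_le hP (by positivity)) x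
    rwa [one_mul] at this
  have h1 : ‖abelResolvent P (2 ^ 0) x‖ ^ 2 ≤ ‖x‖ ^ 2 := by gcongr
  have h2 : 0 ≤ ∑ j ∈ Finset.range K,
      ‖(abelResolvent P (2 ^ j) - abelResolvent P (2 ^ (j + 1))) x‖ ^ 2 :=
    Finset.sum_nonneg fun _ _ => by positivity
  nlinarith [sq_nonneg ‖abelResolvent P (2 ^ K) x‖]

/-- Telescoping of the cut-off `φ(u) = 3u² - 2u³` for commuting arguments. -/
theorem cutoff_sub_cutoff {R : Type*} [Ring R] {a b : R} (h : Commute a b) :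
    (3 * a ^ 2 - 2 * a ^ 3) - (3 * b ^ 2 - 2 * b ^ 3)
      = (2 * (a * (1 - a)) + 2 * (b * (1 - b)) + a * (1 - b) + b * (1 - a)) * (a - b) := by
  have h1 : b * a = a * b := h.eq.symm
  have h2 : a * b * a = a * a * b := by rw [mul_assoc, h1, mul_assoc]
  have h3 : b * b * a = a * b * b := by rw [mul_assoc, h1, ← mul_assoc, h1]
  simp only [pow_succ, pow_zero, one_mul, two_mul, mul_sub, sub_mul, add_mul, mul_one,
    ← mul_assoc, show (3 : R) = 1 + 1 + 1 by norm_num, h1, h2, h3]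
  abel

end Resolvent

/-! ### Truncated fractional powers of 1 - P at low and high frequency -/

section FractionalDifference

variable {H : Type*} [NormedAddCommGroup H] [InnerProductSpace ℝ H] {P : H →L[ℝ] H} {α : ℝ}

/-- Partial sums `∑_{n<L} Bₙ (Pⁿ - Pⁿ⁺¹)` approximating `(∑ (n+1)^(-α) Pⁿ)⁻¹`, which behaves like
the fractional power `(1 - P)^(1-α)`. -/
noncomputable def fracDiff (P : H →L[ℝ] H) (α : ℝ) (L : ℕ) : H →L[ℝ] H :=
  ∑ n ∈ Finset.range L, fracPartial α n • (P ^ n * (1 - P))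

theorem norm_sum_Ico_fracPartial_le (hP : ‖P‖ ≤ 1) (h0 : 0 ≤ α) (M L : ℕ) :
    ‖∑ n ∈ Finset.Ico M L, fracPartial α n • (P ^ n * (1 - P))‖ ≤ 2 * fracPartial α M := by
  have hB := fracPartial_nonneg h0
  rcases le_total L M with h | h
  · rw [Finset.Ico_eq_empty_of_le h, Finset.sum_empty, norm_zero]
    linarith [hB M]
  have hpow : ∀ (c : ℝ) (n : ℕ), 0 ≤ c → ‖c • P ^ n‖ ≤ c := fun c n hc => by
    rw [norm_smul, Real.norm_of_nonneg hc]
    exact mul_le_of_le_one_right hc (contraction_norm_pow_le hP n)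
  -- Summation by parts: with the boundary term added, the sum is B_M P^M - Σ (Bₙ - Bₙ₊₁) Pⁿ⁺¹, of
  -- norm at most B_M + (B_M - B_L).
  have key : ‖∑ n ∈ Finset.Ico M L, fracPartial α n • (P ^ n * (1 - P)) + fracPartial α L • P ^ L‖
      ≤ 2 * fracPartial α M - fracPartial α L := by
    induction L, h using Nat.le_induction with
    | base =>
      rw [Finset.Ico_self, Finset.sum_empty, zero_add]
      linarith [hpow _ M (hB M)]
    | succ L h ih =>
      have hd : 0 ≤ fracPartial α L - fracPartial α (L + 1) :=
        sub_nonneg.2 (fracPartial_antitone h0 (Nat.le_succ L))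
      rw [Finset.sum_Ico_succ_top h]
      have : ∑ n ∈ Finset.Ico M L, fracPartial α n • (P ^ n * (1 - P))
            + fracPartial α L • (P ^ L * (1 - P)) + fracPartial α (L + 1) • P ^ (L + 1)
          = (∑ n ∈ Finset.Ico M L, fracPartial α n • (P ^ n * (1 - P)) + fracPartial α L • P ^ L)
            - (fracPartial α L - fracPartial α (L + 1)) • P ^ (L + 1) := by
        rw [mul_sub, mul_one, ← pow_succ, smul_sub, sub_smul]
        abel
      rw [this]
      linarith [norm_sub_le (∑ n ∈ Finset.Ico M L, fracPartial α n • (P ^ n * (1 - P))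
        + fracPartial α L • P ^ L) ((fracPartial α L - fracPartial α (L + 1)) • P ^ (L + 1)),
        hpow _ (L + 1) hd]
  have := norm_sub_le (∑ n ∈ Finset.Ico M L, fracPartial α n • (P ^ n * (1 - P))
    + fracPartial α L • P ^ L) (fracPartial α L • P ^ L)
  rw [add_sub_cancel_right] at this
  linarith [hpow _ L (hB L)]

theorem fracDiff_eq_add (P : H →L[ℝ] H) (α : ℝ) (M L : ℕ) :
    fracDiff P α L = ∑ n ∈ Finset.range (min M L), fracPartial α n • (P ^ n * (1 - P))
      + ∑ n ∈ Finset.Ico M L, fracPartial α n • (P ^ n * (1 - P)) := by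
  rcases le_total L M with h | h
  · rw [Finset.Ico_eq_empty_of_le h, min_eq_right h, Finset.sum_empty, add_zero, fracDiff]
  · rw [min_eq_left h, fracDiff, Finset.sum_range_add_sum_Ico _ h]

theorem sum_range_min_fracPartial_mul_le (h0 : 0 ≤ α) (M L : ℕ) (c : ℝ) (hc : 0 ≤ c) :
    ∑ n ∈ Finset.range (min M L), fracPartial α n * c ≤ (M : ℝ) ^ α * c := by
  rw [← Finset.sum_mul]
  gcongr
  refine le_trans ?_ (sum_fracPartial_le h0 M)
  refine Finset.sum_le_sum_of_subset_of_nonneg ?_ fun n _ _ => fracPartial_nonneg h0 n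
  exact Finset.range_subset_range.2 (min_le_left M L)

/-- Low-frequency bound. -/
theorem norm_fracDiff_mul_abelResolvent_le [CompleteSpace H] (hP : ‖P‖ ≤ 1) (h0 : 0 ≤ α)
    (h1 : α < 1) (L : ℕ) {t : ℕ} (ht : 1 ≤ t) :
    ‖fracDiff P α L * abelResolvent P t‖ ≤ 4 * (t : ℝ) ^ (α - 1) := by
  have ht0 : (0 : ℝ) < t := by exact_mod_cast ht
  have hU := norm_abelResolvent_le hP ht0.le
  have hAU : ‖(1 - P) * abelResolvent P t‖ ≤ 2 / t := by
    rw [le_div_iff₀' ht0]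
    have := congrArg norm (one_sub_abelResolvent hP ht0.le)
    rw [norm_smul, Real.norm_of_nonneg ht0.le] at this
    rw [← this]
    refine (norm_sub_le _ _).trans ?_
    have : ‖(1 : H →L[ℝ] H)‖ ≤ 1 := ContinuousLinearMap.norm_id_le
    linarith
  -- Cut at n = t. Below, ‖(1-P)U_t‖ ≤ 2/t and ΣBₙ ≤ t^α; above, the tail has norm at most 2B_t and
  -- U_t is a contraction.
  rw [fracDiff_eq_add P α t L, add_mul]
  refine (norm_add_le _ _).trans ?_
  have b1 : ‖(∑ n ∈ Finset.range (min t L), fracPartial α n • (P ^ n * (1 - P)))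
      * abelResolvent P t‖ ≤ (t : ℝ) ^ α * (2 / t) := by
    rw [Finset.sum_mul]
    refine (norm_sum_le _ _).trans (le_trans (Finset.sum_le_sum fun n _ => ?_)
      (sum_range_min_fracPartial_mul_le h0 t L (2 / t) (by positivity)))
    rw [smul_mul_assoc, norm_smul, Real.norm_of_nonneg (fracPartial_nonneg h0 n), mul_assoc]
    refine mul_le_mul_of_nonneg_left ?_ (fracPartial_nonneg h0 n)
    refine (norm_mul_le _ _).trans ((mul_le_of_le_one_left (norm_nonneg _)
      (contraction_norm_pow_le hP n)).trans hAU)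
  have b2 : ‖(∑ n ∈ Finset.Ico t L, fracPartial α n • (P ^ n * (1 - P))) * abelResolvent P t‖
      ≤ 2 * (t : ℝ) ^ (α - 1) := by
    refine (norm_mul_le _ _).trans ((mul_le_of_le_one_right (norm_nonneg _) hU).trans ?_)
    have := norm_sum_Ico_fracPartial_le hP h0 t L
    have := fracPartial_le_of_pos h0 h1 ht
    linarith
  have e : (t : ℝ) ^ α * (2 / t) = 2 * (t : ℝ) ^ (α - 1) := by
    rw [Real.rpow_sub_one ht0.ne']; ring
  linarith

/-- High-frequency bound. -/
theorem norm_pow_mul_fracDiff_mul_one_sub_le (hP : ‖P‖ ≤ 1) (h0 : 0 ≤ α) (h1 : α < 1) {C : ℝ}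
    (hC : ∀ n : ℕ, (n : ℝ) * ‖P ^ n * (1 - P)‖ ≤ C) (L : ℕ) {N : ℕ} (hN : 1 ≤ N) :
    ‖P ^ (2 * N) * fracDiff P α L * (1 - P)‖ ≤ (C ^ 2 + 2 * C) * (N : ℝ) ^ (α - 2) := by
  have hN0 : (0 : ℝ) < N := by exact_mod_cast hN
  have hC0 : 0 ≤ C := by simpa using hC 0
  have hA : ‖P ^ N * (1 - P)‖ ≤ C / N := by rw [le_div_iff₀' hN0]; exact hC N
  have hcA : ∀ n, Commute (P ^ n) (1 - P) := fun n =>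
    ((Commute.one_right P).sub_right (Commute.refl P)).pow_left n
  have hA2 : ‖P ^ (2 * N) * (1 - P) * (1 - P)‖ ≤ (C / N) ^ 2 := by
    have : P ^ (2 * N) * (1 - P) * (1 - P) = (P ^ N * (1 - P)) * (P ^ N * (1 - P)) := by
      rw [two_mul, pow_add, mul_assoc, (hcA N).mul_mul_mul_comm]
    rw [this, sq]
    exact (norm_mul_le _ _).trans (mul_le_mul hA hA (norm_nonneg _) (by positivity))
  -- Each half P^N of P^(2N) can absorb one factor 1 - P at cost C/N. For n < N both are absorbed;
  -- for n ≥ N one is, and the other stays inside the tail bounded by 2B_N.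
  rw [fracDiff_eq_add P α N L, mul_add, add_mul]
  refine (norm_add_le _ _).trans ?_
  have b1 : ‖P ^ (2 * N) * (∑ n ∈ Finset.range (min N L), fracPartial α n • (P ^ n * (1 - P)))
      * (1 - P)‖ ≤ (N : ℝ) ^ α * (C / N) ^ 2 := by
    rw [Finset.mul_sum, Finset.sum_mul]
    refine (norm_sum_le _ _).trans (le_trans (Finset.sum_le_sum fun n _ => ?_)
      (sum_range_min_fracPartial_mul_le h0 N L _ (by positivity)))
    rw [mul_smul_comm, smul_mul_assoc, norm_smul, Real.norm_of_nonneg (fracPartial_nonneg h0 n)]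
    refine mul_le_mul_of_nonneg_left ?_ (fracPartial_nonneg h0 n)
    have : P ^ (2 * N) * (P ^ n * (1 - P)) * (1 - P) = P ^ n * (P ^ (2 * N) * (1 - P) * (1 - P)) := by
      simp only [← mul_assoc, ← pow_add, add_comm n]
    rw [this]
    exact (norm_mul_le _ _).trans ((mul_le_of_le_one_left (norm_nonneg _)
      (contraction_norm_pow_le hP n)).trans hA2)
  have b2 : ‖P ^ (2 * N) * (∑ n ∈ Finset.Ico N L, fracPartial α n • (P ^ n * (1 - P))) * (1 - P)‖
      ≤ C / N * (2 * (N : ℝ) ^ (α - 1)) := by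
    set S := ∑ n ∈ Finset.Ico N L, fracPartial α n • (P ^ n * (1 - P)) with hS
    have hcS : Commute S (1 - P) := by
      refine Commute.sum_left _ _ _ fun n _ => Commute.smul_left ?_ _
      exact (hcA n).mul_left (Commute.refl _)
    have hS2 : ‖S‖ ≤ 2 * (N : ℝ) ^ (α - 1) := by
      have := norm_sum_Ico_fracPartial_le hP h0 N L
      have := fracPartial_le_of_pos h0 h1 hN
      linarith
    have : P ^ (2 * N) * S * (1 - P) = P ^ N * ((P ^ N * (1 - P)) * S) := by
      rw [mul_assoc, hcS.eq, two_mul, pow_add]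
      simp only [mul_assoc]
    rw [this]
    refine (norm_mul_le _ _).trans ((mul_le_of_le_one_left (norm_nonneg _)
      (contraction_norm_pow_le hP N)).trans ((norm_mul_le _ _).trans ?_))
    exact mul_le_mul hA hS2 (norm_nonneg _) (by positivity)
  have e1 : (N : ℝ) ^ α * (C / N) ^ 2 = C ^ 2 * (N : ℝ) ^ (α - 2) := by
    rw [show α - 2 = α - 1 - 1 by ring, Real.rpow_sub_one hN0.ne', Real.rpow_sub_one hN0.ne']
    field_simp
  have e2 : C / N * (2 * (N : ℝ) ^ (α - 1)) = 2 * C * (N : ℝ) ^ (α - 2) := by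
    rw [show α - 2 = α - 1 - 1 by ring, Real.rpow_sub_one hN0.ne' (α - 1)]
    field_simp
  linarith

end FractionalDifference

/-! ### Almost orthogonality and the square function estimate -/

section SquareFunction

/-- With truncated subtraction, (k-j)+(j-k) is |k-j|. -/
theorem sum_range_geom_dist_le {ρ : ℝ} (h0 : 0 ≤ ρ) (h1 : ρ < 1) (k J : ℕ) :
    ∑ j ∈ Finset.range J, ρ ^ ((k - j) + (j - k)) ≤ 2 * (1 - ρ)⁻¹ := by
  have hg : ∀ n, ∑ i ∈ Finset.range n, ρ ^ i ≤ (1 - ρ)⁻¹ := fun n => by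
    rw [← tsum_geometric_of_lt_one h0 h1]
    exact (summable_geometric_of_lt_one h0 h1).sum_le_tsum _ fun i _ => by positivity
  calc ∑ j ∈ Finset.range J, ρ ^ ((k - j) + (j - k))
      ≤ ∑ j ∈ Finset.range (k + 1) ∪ Finset.Ico k J, ρ ^ ((k - j) + (j - k)) := by
        refine Finset.sum_le_sum_of_subset_of_nonneg (fun j hj => ?_) fun j _ _ => by positivity
        simp only [Finset.mem_union, Finset.mem_range, Finset.mem_Ico] at *
        omega
    _ ≤ ∑ j ∈ Finset.range (k + 1), ρ ^ ((k - j) + (j - k))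
        + ∑ j ∈ Finset.Ico k J, ρ ^ ((k - j) + (j - k)) := by
        rw [← Finset.sum_union_inter]
        have : 0 ≤ ∑ j ∈ Finset.range (k + 1) ∩ Finset.Ico k J, ρ ^ ((k - j) + (j - k)) :=
          Finset.sum_nonneg fun j _ => by positivity
        linarith
    _ = ∑ i ∈ Finset.range (k + 1), ρ ^ i + ∑ i ∈ Finset.range (J - k), ρ ^ i := by
        congr 1
        · rw [← Finset.sum_range_reflect]
          refine Finset.sum_congr rfl fun j hj => ?_
          have := Finset.mem_range.1 hj
          congr 1
          omega
        · rw [Finset.sum_Ico_eq_sum_range]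
          refine Finset.sum_congr rfl fun j _ => ?_
          congr 1
          omega
    _ ≤ _ := by linarith [hg (k + 1), hg (J - k)]

theorem sum_sq_geom_dist_le {ρ : ℝ} (h0 : 0 ≤ ρ) (h1 : ρ < 1) (K J : ℕ) (q : ℕ → ℝ) :
    ∑ k ∈ Finset.range K, (∑ j ∈ Finset.range J, ρ ^ ((k - j) + (j - k)) * q j) ^ 2
      ≤ 2 * (1 - ρ)⁻¹ * (2 * (1 - ρ)⁻¹) * ∑ j ∈ Finset.range J, q j ^ 2 := by
  have : 0 < (1 - ρ)⁻¹ := inv_pos.2 (by linarith)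
  apply schur_test _ _ (fun k j => ρ ^ ((k - j) + (j - k))) (fun _ => 1) (fun _ => 1)
  · intro _ _ _ _; positivity
  · intro _ _; exact one_pos
  · positivity
  · intro k _
    simpa using sum_range_geom_dist_le h0 h1 k J
  · intro j _
    simpa [add_comm] using sum_range_geom_dist_le h0 h1 j K

variable {H : Type*} [NormedAddCommGroup H] [InnerProductSpace ℝ H] {P : H →L[ℝ] H} {α : ℝ}

/-- The operator `2^(k(1-α)) P^(2·2^k) (1 - P)^(1-α)`, up to truncation. -/
noncomputable def dyadicFracDiff (P : H →L[ℝ] H) (α : ℝ) (L k : ℕ) : H →L[ℝ] H :=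
  (((2 : ℝ) ^ k) ^ (1 - α)) • (P ^ (2 * 2 ^ k) * fracDiff P α L)

/-- Product of two-sided localized resolvents near the dyadic scale `2^j`. -/
noncomputable def resolventBand (P : H →L[ℝ] H) (j : ℕ) : H →L[ℝ] H :=
  2 * (abelResolvent P (2 ^ j) * (1 - abelResolvent P (2 ^ j)))
    + 2 * (abelResolvent P (2 ^ (j + 1)) * (1 - abelResolvent P (2 ^ (j + 1))))
    + abelResolvent P (2 ^ j) * (1 - abelResolvent P (2 ^ (j + 1)))
    + abelResolvent P (2 ^ (j + 1)) * (1 - abelResolvent P (2 ^ j))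

theorem commute_abelResolvent_abelResolvent (s t : ℝ) :
    Commute (abelResolvent P s) (abelResolvent P t) :=
  commute_abelResolvent (commute_abelResolvent (Commute.refl P) s).symm t

/-- For φ(u) = 3u² - 2u³, φ(0) = 0, φ(1) = 1 and φ' = 6u(1-u) vanishes at both ends; this is why
every term of a band contains both a U and a 1 - U. The end terms are 1 - φ(a) = (1-a)²(1+2a) and
φ(b). -/
theorem eq_sum_resolventBand (P : H →L[ℝ] H) (K : ℕ) :
    (1 : H →L[ℝ] H)
      = (1 - abelResolvent P (2 ^ 0)) * ((1 - abelResolvent P (2 ^ 0)) *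
          (1 + 2 * abelResolvent P (2 ^ 0)))
        + ∑ j ∈ Finset.range K, resolventBand P j *
          (abelResolvent P (2 ^ j) - abelResolvent P (2 ^ (j + 1)))
        + abelResolvent P (2 ^ K) * (3 * abelResolvent P (2 ^ K) - 2 * abelResolvent P (2 ^ K) ^ 2) := by
  have htel : ∑ j ∈ Finset.range K, resolventBand P j *
      (abelResolvent P (2 ^ j) - abelResolvent P (2 ^ (j + 1)))
      = (3 * abelResolvent P (2 ^ 0) ^ 2 - 2 * abelResolvent P (2 ^ 0) ^ 3)
        - (3 * abelResolvent P (2 ^ K) ^ 2 - 2 * abelResolvent P (2 ^ K) ^ 3) := by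
    rw [← Finset.sum_range_sub'
      (fun j => 3 * abelResolvent P (2 ^ j) ^ 2 - 2 * abelResolvent P (2 ^ j) ^ 3)]
    refine Finset.sum_congr rfl fun j _ => ?_
    rw [cutoff_sub_cutoff (commute_abelResolvent_abelResolvent _ _), resolventBand]
  rw [htel]
  generalize abelResolvent P (2 ^ 0) = a
  generalize abelResolvent P (2 ^ K) = b
  noncomm_ring

variable [CompleteSpace H]

theorem norm_one_sub_abelResolvent_le (hP : ‖P‖ ≤ 1) {t : ℝ} (ht : 0 ≤ t) :
    ‖1 - abelResolvent P t‖ ≤ 2 := by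
  have : ‖(1 : H →L[ℝ] H)‖ ≤ 1 := ContinuousLinearMap.norm_id_le
  linarith [norm_sub_le (1 : H →L[ℝ] H) (abelResolvent P t), norm_abelResolvent_le hP ht]

/-- Keeps the U factor of each term next to T, for use with the low-frequency bound; the companion
estimate keeps 1 - U, for the high-frequency one. -/
theorem norm_mul_resolventBand_le_left (hP : ‖P‖ ≤ 1) (T : H →L[ℝ] H) (j : ℕ) :
    ‖T * resolventBand P j‖ ≤
      6 * (‖T * abelResolvent P (2 ^ j)‖ + ‖T * abelResolvent P (2 ^ (j + 1))‖) := by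
  have hV0 := norm_one_sub_abelResolvent_le hP (show (0 : ℝ) ≤ 2 ^ j by positivity)
  have hV1 := norm_one_sub_abelResolvent_le hP (show (0 : ℝ) ≤ 2 ^ (j + 1) by positivity)
  rw [resolventBand]
  generalize abelResolvent P (2 ^ j) = a at *
  generalize abelResolvent P (2 ^ (j + 1)) = b at *
  have key : ∀ u v : H →L[ℝ] H, ‖1 - v‖ ≤ 2 → ‖T * u * (1 - v)‖ ≤ 2 * ‖T * u‖ := fun u v hv => by
    refine (norm_mul_le _ _).trans ?_
    rw [mul_comm]
    gcongr
  have e : T * (2 * (a * (1 - a)) + 2 * (b * (1 - b)) + a * (1 - b) + b * (1 - a))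
      = T * a * (1 - a) + T * a * (1 - a) + (T * b * (1 - b) + T * b * (1 - b))
        + T * a * (1 - b) + T * b * (1 - a) := by
    simp only [two_mul, mul_add, mul_assoc]
  rw [e]
  refine (norm_add₃_le).trans ?_
  have n1 := norm_add_le (T * a * (1 - a) + T * a * (1 - a)) (T * b * (1 - b) + T * b * (1 - b))
  have n2 := norm_add_le (T * a * (1 - a)) (T * a * (1 - a))
  have n3 := norm_add_le (T * b * (1 - b)) (T * b * (1 - b))
  linarith [key a a hV0, key b b hV1, key a b hV1, key b a hV0]

theorem norm_mul_resolventBand_le_right (hP : ‖P‖ ≤ 1) (T : H →L[ℝ] H) (j : ℕ) :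
    ‖T * resolventBand P j‖ ≤
      3 * (‖T * (1 - abelResolvent P (2 ^ j))‖ + ‖T * (1 - abelResolvent P (2 ^ (j + 1)))‖) := by
  have hU0 := norm_abelResolvent_le hP (show (0 : ℝ) ≤ 2 ^ j by positivity)
  have hU1 := norm_abelResolvent_le hP (show (0 : ℝ) ≤ 2 ^ (j + 1) by positivity)
  have hab := commute_abelResolvent_abelResolvent (P := P) (2 ^ j) (2 ^ (j + 1))
  rw [resolventBand]
  generalize abelResolvent P (2 ^ j) = a at *
  generalize abelResolvent P (2 ^ (j + 1)) = b at *
  have key : ∀ u v : H →L[ℝ] H, ‖v‖ ≤ 1 → ‖T * (1 - u) * v‖ ≤ ‖T * (1 - u)‖ := fun u v hv =>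
    (norm_mul_le _ _).trans (mul_le_of_le_one_right (norm_nonneg _) hv)
  have c1 : a * (1 - a) = (1 - a) * a := by rw [mul_sub, sub_mul, mul_one, one_mul]
  have c2 : b * (1 - b) = (1 - b) * b := by rw [mul_sub, sub_mul, mul_one, one_mul]
  have c3 : a * (1 - b) = (1 - b) * a := by rw [mul_sub, sub_mul, mul_one, one_mul, hab.eq]
  have c4 : b * (1 - a) = (1 - a) * b := by rw [mul_sub, sub_mul, mul_one, one_mul, hab.eq]
  have e : T * (2 * (a * (1 - a)) + 2 * (b * (1 - b)) + a * (1 - b) + b * (1 - a))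
      = T * (1 - a) * a + T * (1 - a) * a + (T * (1 - b) * b + T * (1 - b) * b)
        + T * (1 - b) * a + T * (1 - a) * b := by
    rw [c1, c2, c3, c4]
    simp only [two_mul, mul_add, mul_assoc]
  rw [e]
  refine (norm_add₃_le).trans ?_
  have n1 := norm_add_le (T * (1 - a) * a + T * (1 - a) * a) (T * (1 - b) * b + T * (1 - b) * b)
  have n2 := norm_add_le (T * (1 - a) * a) (T * (1 - a) * a)
  have n3 := norm_add_le (T * (1 - b) * b) (T * (1 - b) * b)
  linarith [key a a hU0, key b b hU1, key b a hU0, key a b hU1]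

theorem norm_dyadicFracDiff_mul_abelResolvent_le (hP : ‖P‖ ≤ 1) (h0 : 0 ≤ α) (h1 : α < 1)
    (L k j : ℕ) :
    ‖dyadicFracDiff P α L k * abelResolvent P (2 ^ j)‖
      ≤ 4 * (((2 : ℝ) ^ k) ^ (1 - α) * ((2 : ℝ) ^ j) ^ (α - 1)) := by
  rw [dyadicFracDiff, smul_mul_assoc, norm_smul, Real.norm_of_nonneg (by positivity), mul_assoc,
    mul_left_comm]
  gcongr
  refine (norm_mul_le _ _).trans ((mul_le_of_le_one_left (norm_nonneg _)
    (contraction_norm_pow_le hP _)).trans ?_)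
  have := norm_fracDiff_mul_abelResolvent_le hP h0 h1 L (Nat.one_le_two_pow (n := j))
  push_cast at this
  exact this

theorem norm_dyadicFracDiff_mul_one_sub_abelResolvent_le (hP : ‖P‖ ≤ 1) (h0 : 0 ≤ α) (h1 : α < 1)
    {C : ℝ} (hC : ∀ n : ℕ, (n : ℝ) * ‖P ^ n * (1 - P)‖ ≤ C) (L k j : ℕ) :
    ‖dyadicFracDiff P α L k * (1 - abelResolvent P (2 ^ j))‖
      ≤ (C ^ 2 + 2 * C) * ((2 : ℝ) ^ j * ((2 : ℝ) ^ k)⁻¹) := by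
  have ht : (0 : ℝ) ≤ 2 ^ j := by positivity
  have hk : (0 : ℝ) < 2 ^ k := by positivity
  have hb := norm_pow_mul_fracDiff_mul_one_sub_le hP h0 h1 hC L (Nat.one_le_two_pow (n := k))
  push_cast at hb
  rw [one_sub_abelResolvent hP ht, mul_smul_comm, norm_smul, Real.norm_of_nonneg ht,
    mul_left_comm]
  gcongr
  rw [dyadicFracDiff, smul_mul_assoc, norm_smul, Real.norm_of_nonneg (by positivity), ← mul_assoc]
  calc _ ≤ ((2 : ℝ) ^ k) ^ (1 - α) * ((C ^ 2 + 2 * C) * ((2 : ℝ) ^ k) ^ (α - 2)) := by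
        gcongr
        refine (norm_mul_le _ _).trans ((mul_le_of_le_one_right (norm_nonneg _)
          (norm_abelResolvent_le hP ht)).trans hb)
    _ = _ := by
        rw [mul_left_comm, ← Real.rpow_add hk, ← Real.rpow_neg_one]
        congr 2; ring

theorem rpow_two_pow_mul (α : ℝ) {j k : ℕ} (hkj : k ≤ j) :
    ((2 : ℝ) ^ k) ^ (1 - α) * ((2 : ℝ) ^ j) ^ (α - 1) = ((2 : ℝ) ^ (α - 1)) ^ (j - k) := by
  rw [← Real.rpow_natCast, ← Real.rpow_natCast, ← Real.rpow_natCast, ← Real.rpow_mul (by norm_num),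
    ← Real.rpow_mul (by norm_num), ← Real.rpow_mul (by norm_num), ← Real.rpow_add (by norm_num),
    Nat.cast_sub hkj]
  congr 1; ring

theorem two_pow_mul_inv_le (h0 : 0 ≤ α) {j k : ℕ} (hjk : j ≤ k) :
    (2 : ℝ) ^ j * ((2 : ℝ) ^ k)⁻¹ ≤ ((2 : ℝ) ^ (α - 1)) ^ (k - j) := by
  have : (2 : ℝ) ^ j * ((2 : ℝ) ^ k)⁻¹ = ((2 : ℝ) ^ (-1 : ℝ)) ^ (k - j) := by
    obtain ⟨d, rfl⟩ := Nat.exists_eq_add_of_le hjk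
    rw [Nat.add_sub_cancel_left, Real.rpow_neg_one, pow_add, inv_pow]
    field_simp
  rw [this]
  gcongr
  · norm_num
  · linarith

/-- For k ≤ j the low-frequency bound decays like 2^(-(1-α)(j-k)). For k > j the high-frequency
bound decays like 2^(-(k-j)), which is weakened to the same rate. -/
theorem norm_dyadicFracDiff_mul_resolventBand_le (hP : ‖P‖ ≤ 1) (h0 : 0 ≤ α) (h1 : α < 1)
    {C : ℝ} (hC : ∀ n : ℕ, (n : ℝ) * ‖P ^ n * (1 - P)‖ ≤ C) (L k j : ℕ) :
    ‖dyadicFracDiff P α L k * resolventBand P j‖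
      ≤ (48 + 9 * (C ^ 2 + 2 * C)) * ((2 : ℝ) ^ (α - 1)) ^ ((k - j) + (j - k)) := by
  have hC0 : 0 ≤ C := by simpa using hC 0
  have hρ : (0 : ℝ) < (2 : ℝ) ^ (α - 1) := by positivity
  have hρ1 : (2 : ℝ) ^ (α - 1) ≤ 1 := Real.rpow_le_one_of_one_le_of_nonpos (by norm_num) (by linarith)
  rcases le_or_gt k j with h | h
  · have hb := norm_mul_resolventBand_le_left hP (dyadicFracDiff P α L k) j
    have b0 := norm_dyadicFracDiff_mul_abelResolvent_le hP h0 h1 L k j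
    have b1 := norm_dyadicFracDiff_mul_abelResolvent_le hP h0 h1 L k (j + 1)
    rw [rpow_two_pow_mul α h] at b0
    have e : ((2 : ℝ) ^ (α - 1)) ^ (j + 1 - k) = ((2 : ℝ) ^ (α - 1)) ^ (j - k) * (2 : ℝ) ^ (α - 1) := by
      rw [Nat.succ_sub h, pow_succ]
    rw [rpow_two_pow_mul α (h.trans (Nat.le_succ j)), e] at b1
    rw [Nat.sub_eq_zero_of_le h, zero_add]
    have hp : 0 ≤ ((2 : ℝ) ^ (α - 1)) ^ (j - k) := by positivity
    have : ((2 : ℝ) ^ (α - 1)) ^ (j - k) * (2 : ℝ) ^ (α - 1) ≤ ((2 : ℝ) ^ (α - 1)) ^ (j - k) :=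
      mul_le_of_le_one_right hp hρ1
    have : 0 ≤ 9 * (C ^ 2 + 2 * C) * ((2 : ℝ) ^ (α - 1)) ^ (j - k) := by positivity
    linarith
  · have hb := norm_mul_resolventBand_le_right hP (dyadicFracDiff P α L k) j
    have b0 := norm_dyadicFracDiff_mul_one_sub_abelResolvent_le hP h0 h1 hC L k j
    have b1 := norm_dyadicFracDiff_mul_one_sub_abelResolvent_le hP h0 h1 hC L k (j + 1)
    have e : (2 : ℝ) ^ (j + 1) * ((2 : ℝ) ^ k)⁻¹ = 2 * ((2 : ℝ) ^ j * ((2 : ℝ) ^ k)⁻¹) := by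
      rw [pow_succ', mul_assoc]
    rw [e] at b1
    have hg := two_pow_mul_inv_le h0 h.le
    rw [Nat.sub_eq_zero_of_le h.le, add_zero]
    have hp : 0 ≤ ((2 : ℝ) ^ (α - 1)) ^ (k - j) := by positivity
    have : (C ^ 2 + 2 * C) * ((2 : ℝ) ^ j * ((2 : ℝ) ^ k)⁻¹)
        ≤ (C ^ 2 + 2 * C) * ((2 : ℝ) ^ (α - 1)) ^ (k - j) := by gcongr
    linarith

/-- Insert the resolution of the identity with K bands. The two end terms decay geometrically in the
distance of k from 0 and from K. -/
theorem norm_dyadicFracDiff_apply_le (hP : ‖P‖ ≤ 1) (h0 : 0 ≤ α) (h1 : α < 1)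
    {C : ℝ} (hC : ∀ n : ℕ, (n : ℝ) * ‖P ^ n * (1 - P)‖ ≤ C) (L : ℕ) {k K : ℕ} (hk : k ≤ K)
    (g : H) :
    ‖dyadicFracDiff P α L k g‖ ≤ 6 * (C ^ 2 + 2 * C) * ‖g‖ * ((2 : ℝ) ^ (α - 1)) ^ k
      + (48 + 9 * (C ^ 2 + 2 * C)) * ∑ j ∈ Finset.range K,
          ((2 : ℝ) ^ (α - 1)) ^ ((k - j) + (j - k)) *
            ‖(abelResolvent P (2 ^ j) - abelResolvent P (2 ^ (j + 1))) g‖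
      + 20 * ‖g‖ * ((2 : ℝ) ^ (α - 1)) ^ (K - k) := by
  have hC0 : 0 ≤ C := by simpa using hC 0
  have hone : ‖(1 : H →L[ℝ] H)‖ ≤ 1 := ContinuousLinearMap.norm_id_le
  set T := dyadicFracDiff P α L k with hT
  have hdec : T g = (T * (1 - abelResolvent P (2 ^ 0))) (((1 - abelResolvent P (2 ^ 0)) *
          (1 + 2 * abelResolvent P (2 ^ 0))) g)
        + ∑ j ∈ Finset.range K, (T * resolventBand P j)
          ((abelResolvent P (2 ^ j) - abelResolvent P (2 ^ (j + 1))) g)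
        + (T * abelResolvent P (2 ^ K))
          ((3 * abelResolvent P (2 ^ K) - 2 * abelResolvent P (2 ^ K) ^ 2 : H →L[ℝ] H) g) := by
    have h := congrArg (fun S : H →L[ℝ] H => (T * S) g) (eq_sum_resolventBand P K)
    simp only [mul_one, mul_add, Finset.mul_sum, add_apply, sum_apply, ← mul_assoc] at h
    rw [h]
    simp only [mul_apply_eq_comp, mul_add, mul_one, add_apply, map_add, mul_assoc]
  rw [hdec]
  refine norm_add₃_le.trans ?_
  have hU0 := norm_abelResolvent_le hP (show (0 : ℝ) ≤ 2 ^ 0 by positivity)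
  have hUK := norm_abelResolvent_le hP (show (0 : ℝ) ≤ 2 ^ K by positivity)
  have hV0 := norm_one_sub_abelResolvent_le hP (show (0 : ℝ) ≤ 2 ^ 0 by positivity)
  have htwo : ∀ S : H →L[ℝ] H, ‖2 * S‖ ≤ 2 * ‖S‖ := fun S => by
    rw [two_mul, two_mul]; exact norm_add_le _ _
  refine add_le_add (add_le_add ?_ ?_) ?_
  · have hb := norm_dyadicFracDiff_mul_one_sub_abelResolvent_le hP h0 h1 hC L k 0
    have hg := two_pow_mul_inv_le h0 (Nat.zero_le k)
    rw [Nat.sub_zero] at hg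
    have hS : ‖(1 - abelResolvent P (2 ^ 0)) * (1 + 2 * abelResolvent P (2 ^ 0))‖ ≤ 6 := by
      refine (norm_mul_le _ _).trans ?_
      have : ‖1 + 2 * abelResolvent P (2 ^ 0)‖ ≤ 3 := by
        linarith [norm_add_le 1 (2 * abelResolvent P (2 ^ 0)), htwo (abelResolvent P (2 ^ 0))]
      calc _ ≤ (2 : ℝ) * 3 := by gcongr
        _ = 6 := by norm_num
    calc _ ≤ ((C ^ 2 + 2 * C) * ((2 : ℝ) ^ (α - 1)) ^ k) * (6 * ‖g‖) := by
          refine (ContinuousLinearMap.le_opNorm _ _).trans ?_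
          refine mul_le_mul (hb.trans (by gcongr)) ?_ (norm_nonneg _) (by positivity)
          exact ContinuousLinearMap.le_of_opNorm_le _ hS g
      _ = _ := by ring
  · rw [Finset.mul_sum]
    refine (norm_sum_le _ _).trans (Finset.sum_le_sum fun j _ => ?_)
    rw [← mul_assoc]
    exact ContinuousLinearMap.le_of_opNorm_le _
      (norm_dyadicFracDiff_mul_resolventBand_le hP h0 h1 hC L k j) _
  · have hb := norm_dyadicFracDiff_mul_abelResolvent_le hP h0 h1 L k K
    rw [rpow_two_pow_mul α hk] at hb
    have hS : ‖3 * abelResolvent P (2 ^ K) - 2 * abelResolvent P (2 ^ K) ^ 2‖ ≤ 5 := by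
      generalize abelResolvent P (2 ^ K) = U at *
      have e : 3 * U - 2 * U ^ 2 = 2 * U + U - 2 * (U * U) := by noncomm_ring
      rw [e]
      have h2 : ‖U * U‖ ≤ 1 := (norm_mul_le _ _).trans (mul_le_one₀ hUK (norm_nonneg _) hUK)
      linarith [norm_sub_le (2 * U + U) (2 * (U * U)), norm_add_le (2 * U) U, htwo U,
        htwo (U * U)]
    calc _ ≤ (4 * ((2 : ℝ) ^ (α - 1)) ^ (K - k)) * (5 * ‖g‖) := by
          refine (ContinuousLinearMap.le_opNorm _ _).trans ?_
          refine mul_le_mul hb ?_ (norm_nonneg _) (by positivity)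
          exact ContinuousLinearMap.le_of_opNorm_le _ hS g
      _ = _ := by ring

/-- Square function estimate for Ritt contractions, uniform in the truncation. -/
theorem exists_sum_norm_sq_dyadicFracDiff_le (hP : ‖P‖ ≤ 1) (h0 : 0 ≤ α) (h1 : α < 1)
    {C : ℝ} (hC : ∀ n : ℕ, (n : ℝ) * ‖P ^ n * (1 - P)‖ ≤ C) :
    ∃ D : ℝ, 0 ≤ D ∧ ∀ (L K : ℕ) (g : H),
      ∑ k ∈ Finset.range K, ‖dyadicFracDiff P α L k g‖ ^ 2 ≤ D * ‖g‖ ^ 2 := by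
  set ρ : ℝ := (2 : ℝ) ^ (α - 1) with hρ
  have hρ0 : 0 ≤ ρ := by positivity
  have hρ1 : ρ < 1 := Real.rpow_lt_one_of_one_lt_of_neg (by norm_num) (by linarith)
  set s : ℝ := 2 * (1 - ρ)⁻¹ with hs
  have hs0 : 0 ≤ s := by
    have : 0 < (1 - ρ)⁻¹ := inv_pos.2 (by linarith)
    positivity
  set E : ℝ := C ^ 2 + 2 * C with hE
  refine ⟨3 * ((6 * E) ^ 2 * s + (48 + 9 * E) ^ 2 * (s * s) + 20 ^ 2 * s), by positivity,
    fun L K g => ?_⟩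
  set q : ℕ → ℝ := fun j => ‖(abelResolvent P (2 ^ j) - abelResolvent P (2 ^ (j + 1))) g‖
  have hpt : ∀ k ∈ Finset.range K, ‖dyadicFracDiff P α L k g‖ ^ 2
      ≤ 3 * ((6 * E * ‖g‖) ^ 2 * ρ ^ k
        + (48 + 9 * E) ^ 2 * (∑ j ∈ Finset.range K, ρ ^ ((k - j) + (j - k)) * q j) ^ 2
        + (20 * ‖g‖) ^ 2 * ρ ^ (K - k)) := by
    intro k hk
    have hb := norm_dyadicFracDiff_apply_le hP h0 h1 hC L (Finset.mem_range.1 hk).le g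
    -- Lets the end terms be summed with ratio ρ instead of ρ².
    have hsq : ∀ n : ℕ, (ρ ^ n) ^ 2 ≤ ρ ^ n := fun n =>
      pow_le_of_le_one (by positivity) (pow_le_one₀ hρ0 hρ1.le) two_ne_zero
    calc ‖dyadicFracDiff P α L k g‖ ^ 2 ≤ _ := pow_le_pow_left₀ (norm_nonneg _) hb 2
      _ ≤ 3 * ((6 * E * ‖g‖ * ρ ^ k) ^ 2
        + ((48 + 9 * E) * (∑ j ∈ Finset.range K, ρ ^ ((k - j) + (j - k)) * q j)) ^ 2
        + (20 * ‖g‖ * ρ ^ (K - k)) ^ 2) := by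
          generalize 6 * E * ‖g‖ * ρ ^ k = x
          generalize (48 + 9 * E) * (∑ j ∈ Finset.range K, ρ ^ ((k - j) + (j - k)) * q j) = y
          generalize 20 * ‖g‖ * ρ ^ (K - k) = z
          nlinarith [sq_nonneg (x - y), sq_nonneg (y - z), sq_nonneg (x - z)]
      _ ≤ _ := by
          simp only [mul_pow _ _ 2] at *
          gcongr
          · exact hsq k
          · exact hsq (K - k)
  refine (Finset.sum_le_sum hpt).trans ?_
  rw [← Finset.mul_sum, Finset.sum_add_distrib, Finset.sum_add_distrib, ← Finset.mul_sum,
    ← Finset.mul_sum, ← Finset.mul_sum]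
  have g1 : ∑ k ∈ Finset.range K, ρ ^ k ≤ s := by
    simpa using sum_range_geom_dist_le hρ0 hρ1 0 K
  have g2 : ∑ k ∈ Finset.range K, ρ ^ (K - k) ≤ s := by
    refine le_trans (le_of_eq ?_) (sum_range_geom_dist_le hρ0 hρ1 K K)
    refine Finset.sum_congr rfl fun k hk => ?_
    rw [Nat.sub_eq_zero_of_le (Finset.mem_range.1 hk).le, add_zero]
  have g3 : ∑ k ∈ Finset.range K,
      (∑ j ∈ Finset.range K, ρ ^ ((k - j) + (j - k)) * q j) ^ 2 ≤ s * s * ‖g‖ ^ 2 := by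
    refine (sum_sq_geom_dist_le hρ0 hρ1 K K q).trans ?_
    gcongr
    exact sum_norm_sq_abelResolvent_sub_le hP K g
  calc _ ≤ 3 * ((6 * E * ‖g‖) ^ 2 * s + (48 + 9 * E) ^ 2 * (s * s * ‖g‖ ^ 2)
        + (20 * ‖g‖) ^ 2 * s) := by gcongr
    _ = _ := by ring

end SquareFunction

/-! ### Recovering f from the partial sums, and convergence implies square summability -/

section Reconstruction

variable {H : Type*} [NormedAddCommGroup H] [InnerProductSpace ℝ H] {P : H →L[ℝ] H} {α : ℝ}

/-- Grouping by i + j = m yields the coefficients of (1/A)·A = 1. -/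
theorem sum_triangle_recipCoeff_smul {E : Type*} [AddCommGroup E] [Module ℝ E] {a : ℕ → ℝ}
    (h0 : a 0 = 1) (x : ℕ → E) {L : ℕ} (hL : 1 ≤ L) :
    ∑ i ∈ Finset.range L, ∑ j ∈ Finset.range (L - i), (recipCoeff a i * a j) • x (i + j) = x 0 := by
  rw [← Finset.sum_range_diag_flip L (fun i j => (recipCoeff a i * a j) • x (i + j))]
  have h : ∀ m ∈ Finset.range L, ∑ k ∈ Finset.range (m + 1),
      (recipCoeff a k * a (m - k)) • x (k + (m - k)) = (if m = 0 then (1 : ℝ) else 0) • x m := by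
    intro m _
    rw [← sum_recipCoeff_mul h0 m, Finset.sum_smul]
    refine Finset.sum_congr rfl fun k hk => ?_
    rw [Nat.add_sub_cancel' (Nat.lt_succ_iff.1 (Finset.mem_range.1 hk))]
  rw [Finset.sum_congr rfl h, Finset.sum_eq_single 0]
  · simp
  · intro m _ hm
    simp [hm]
  · intro h'
    simp at h'
    omega

theorem sum_square_recipCoeff_smul_sub {E : Type*} [AddCommGroup E] [Module ℝ E] {a : ℕ → ℝ}
    (h0 : a 0 = 1) (x : ℕ → E) (L : ℕ) :
    ∑ i ∈ Finset.range (L + 1), ∑ j ∈ Finset.range (L + 1), (recipCoeff a i * a j) • x (i + j)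
      - x 0 = ∑ i ∈ Finset.range (L + 1), ∑ j ∈ Finset.Ico (L + 1 - i) (L + 1),
        (recipCoeff a i * a j) • x (i + j) := by
  rw [← sum_triangle_recipCoeff_smul h0 x (Nat.succ_pos L), sub_eq_iff_eq_add',
    ← Finset.sum_add_distrib]
  refine Finset.sum_congr rfl fun i _ => ?_
  rw [Finset.sum_range_add_sum_Ico _ (Nat.sub_le _ _)]

/-- The square minus the triangle contains only i ≥ 1 and i + j ≥ L + 1, so all its coefficients are
nonpositive and the powers of P have norm at most ‖P^(L+1)f‖ at f. The scalar case of the identity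
shows that their total mass is 1 minus a nonnegative number. -/
theorem norm_sum_square_recipCoeff_sub_le (hP : ‖P‖ ≤ 1) {a : ℕ → ℝ} (h0 : a 0 = 1)
    (hpos : ∀ n, 0 < a n) (hanti : Antitone a)
    (hlog : ∀ m n, m ≤ n → a n * a (m + 1) ≤ a (n + 1) * a m) (f : H) (L : ℕ) :
    ‖∑ i ∈ Finset.range (L + 1), ∑ j ∈ Finset.range (L + 1),
        (recipCoeff a i * a j) • (P ^ (i + j)) f - f‖ ≤ ‖(P ^ (L + 1)) f‖ := by
  have hone := sum_square_recipCoeff_smul_sub h0 (fun _ => (1 : ℝ)) L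
  have hH := sum_square_recipCoeff_smul_sub h0 (fun n => (P ^ n) f) L
  simp only [pow_zero, one_apply_eq_self] at hH
  rw [hH]
  have hb : ∀ i ∈ Finset.range (L + 1), ∀ j ∈ Finset.Ico (L + 1 - i) (L + 1),
      ‖(recipCoeff a i * a j) • (P ^ (i + j)) f‖
        ≤ -(recipCoeff a i * a j) * ‖(P ^ (L + 1)) f‖ := by
    intro i _ j hj
    rw [Finset.mem_Ico] at hj
    have hi : recipCoeff a i ≤ 0 := by
      have := recipCoeff_succ_nonpos h0 hpos hlog (i - 1)
      rwa [Nat.sub_add_cancel (by omega)] at this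
    have hij : recipCoeff a i * a j ≤ 0 := mul_nonpos_of_nonpos_of_nonneg hi (hpos j).le
    rw [norm_smul, Real.norm_of_nonpos hij]
    refine mul_le_mul_of_nonneg_left ?_ (by linarith)
    exact contraction_antitone_norm_pow_apply hP f (by omega)
  refine (norm_sum_le _ _).trans ?_
  refine (Finset.sum_le_sum fun i hi => (norm_sum_le _ _).trans (Finset.sum_le_sum (hb i hi))).trans
    ?_
  simp only [← Finset.sum_mul]
  refine mul_le_of_le_one_left (norm_nonneg _) ?_
  simp only [Finset.sum_neg_distrib, smul_eq_mul, mul_one] at hone ⊢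
  rw [← hone, ← Finset.sum_mul_sum]
  have : 0 ≤ (∑ i ∈ Finset.range (L + 1), recipCoeff a i) * ∑ j ∈ Finset.range (L + 1), a j :=
    mul_nonneg (recipPartial_nonneg h0 hpos hanti hlog L) (Finset.sum_nonneg fun j _ => (hpos j).le)
  linarith

theorem fracDiff_succ (P : H →L[ℝ] H) (α : ℝ) (L : ℕ) :
    fracDiff P α (L + 1)
      = ∑ n ∈ Finset.range (L + 1), recipCoeff (fun n : ℕ => ((n : ℝ) + 1) ^ (-α)) n • P ^ n
        - fracPartial α L • P ^ (L + 1) := by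
  induction L with
  | zero => simp [fracDiff, fracPartial, recipPartial, smul_sub]
  | succ L ih =>
    rw [fracDiff, Finset.sum_range_succ, ← fracDiff, ih, Finset.sum_range_succ _ (L + 1)]
    have : fracPartial α (L + 1) = fracPartial α L
        + recipCoeff (fun n : ℕ => ((n : ℝ) + 1) ^ (-α)) (L + 1) := recipPartial_succ _ _
    rw [mul_sub, mul_one, ← pow_succ, smul_sub, this, add_smul]
    abel

theorem norm_fracDiff_apply_sum_sub_le (hP : ‖P‖ ≤ 1) (h0 : 0 ≤ α) (f : H) (L : ℕ) :
    ‖fracDiff P α (L + 1) (∑ n ∈ Finset.range (L + 1), ((n : ℝ) + 1) ^ (-α) • (P ^ n) f) - f‖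
      ≤ ‖(P ^ (L + 1)) f‖ + fracPartial α L *
        ‖∑ n ∈ Finset.range (L + 1), ((n : ℝ) + 1) ^ (-α) • (P ^ n) f‖ := by
  set g := ∑ n ∈ Finset.range (L + 1), ((n : ℝ) + 1) ^ (-α) • (P ^ n) f with hg
  have hB := fracPartial_nonneg h0 L
  have h := norm_sum_square_recipCoeff_sub_le hP (a := fun n : ℕ => ((n : ℝ) + 1) ^ (-α))
    rpow_neg_zero_eq_one (fun n => by positivity) (rpow_neg_antitone h0) (rpow_neg_logConvex h0) f L
  have e : (∑ n ∈ Finset.range (L + 1),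
      recipCoeff (fun n : ℕ => ((n : ℝ) + 1) ^ (-α)) n • P ^ n) g
      = ∑ i ∈ Finset.range (L + 1), ∑ j ∈ Finset.range (L + 1),
        (recipCoeff (fun n : ℕ => ((n : ℝ) + 1) ^ (-α)) i * ((j : ℝ) + 1) ^ (-α))
          • (P ^ (i + j)) f := by
    rw [sum_apply]
    refine Finset.sum_congr rfl fun i _ => ?_
    rw [smul_apply, hg, map_sum, Finset.smul_sum]
    refine Finset.sum_congr rfl fun j _ => ?_
    rw [map_smul, smul_smul, pow_add, mul_apply_eq_comp]
  rw [fracDiff_succ, sub_apply, e, sub_right_comm]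
  refine (norm_sub_le _ _).trans (add_le_add h ?_)
  rw [smul_apply, norm_smul, Real.norm_of_nonneg hB]
  gcongr
  simpa using (P ^ (L + 1)).le_of_opNorm_le (contraction_norm_pow_le hP _) g

theorem norm_pow_apply_sub_pow_apply_le {C : ℝ}
    (hC : ∀ n : ℕ, (n : ℝ) * ‖P ^ n * (1 - P)‖ ≤ C) (f : H) {N : ℕ} (hN : 1 ≤ N) (i : ℕ) :
    ‖(P ^ (N + i)) f - (P ^ N) f‖ ≤ i * (C / N * ‖f‖) := by
  have hN0 : (0 : ℝ) < N := by exact_mod_cast hN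
  have hC0 : 0 ≤ C := by simpa using hC 0
  induction i with
  | zero => simp
  | succ i ih =>
    have hstep : ‖(P ^ (N + i)) f - (P ^ (N + (i + 1))) f‖ ≤ C / N * ‖f‖ := by
      have e : (P ^ (N + i)) f - (P ^ (N + (i + 1))) f = (P ^ (N + i) * (1 - P)) f := by
        rw [mul_sub, mul_one, ← pow_succ, sub_apply, add_assoc]
      rw [e]
      refine ContinuousLinearMap.le_of_opNorm_le _ ?_ f
      rw [le_div_iff₀' hN0]
      refine le_trans ?_ (hC (N + i))
      gcongr
      omega
    have := norm_sub_le_norm_sub_add_norm_sub ((P ^ (N + (i + 1))) f) ((P ^ (N + i)) f) ((P ^ N) f)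
    rw [norm_sub_rev ((P ^ (N + (i + 1))) f) ((P ^ (N + i)) f)] at this
    rw [Nat.cast_succ]
    linarith

/-- On the block [Km, Km+m) the Ritt condition keeps the orbit within C‖f‖/K of P^(Km)f. The
weighted sum over the block is at most 2G, while its total weight is at least m^(1-α)(K+1)^(-α). Let
m → ∞, then K → ∞. -/
theorem tendsto_norm_pow_apply_zero_of_bounded (hP : ‖P‖ ≤ 1) (h0 : 0 ≤ α) (h1 : α < 1) {C : ℝ}
    (hC : ∀ n : ℕ, (n : ℝ) * ‖P ^ n * (1 - P)‖ ≤ C) {f : H} {G : ℝ}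
    (hG : ∀ N : ℕ, ‖∑ n ∈ Finset.range N, ((n : ℝ) + 1) ^ (-α) • (P ^ n) f‖ ≤ G) :
    Tendsto (fun n : ℕ => ‖(P ^ n) f‖) atTop (𝓝 0) := by
  have hC0 : 0 ≤ C := by simpa using hC 0
  have hG0 : 0 ≤ G := by simpa using hG 0
  have hblock : ∀ K m : ℕ, 1 ≤ K → 1 ≤ m →
      ‖(P ^ (K * m)) f‖ ≤ 2 * G * ((K : ℝ) + 1) ^ α * (m : ℝ) ^ (-(1 - α)) + C * ‖f‖ / K := by
    intro K m hK hm
    have hK0 : (0 : ℝ) < K := by exact_mod_cast hK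
    have hm0 : (0 : ℝ) < m := by exact_mod_cast hm
    have hKm : 1 ≤ K * m := Nat.mul_pos hK hm
    set s := ∑ i ∈ Finset.range m, (((K * m + i : ℕ) : ℝ) + 1) ^ (-α) with hs
    have hs_low : (m : ℝ) ^ (1 - α) * ((K : ℝ) + 1) ^ (-α) ≤ s := by
      have : ∑ _i ∈ Finset.range m, (((K : ℝ) + 1) * m) ^ (-α) ≤ s := by
        refine Finset.sum_le_sum fun i hi => ?_
        apply Real.rpow_le_rpow_of_nonpos (by positivity) _ (by linarith)
        have : (i : ℝ) + 1 ≤ m := by exact_mod_cast Finset.mem_range.1 hi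
        push_cast
        linarith
      refine le_trans (le_of_eq ?_) this
      rw [Finset.sum_const, Finset.card_range, nsmul_eq_mul,
        Real.mul_rpow (by positivity) hm0.le, sub_eq_add_neg, Real.rpow_add hm0, Real.rpow_one]
      ring
    have hs0 : 0 < s := lt_of_lt_of_le (by positivity) hs_low
    have hsum : ‖∑ i ∈ Finset.range m,
        (((K * m + i : ℕ) : ℝ) + 1) ^ (-α) • (P ^ (K * m + i)) f‖ ≤ 2 * G := by
      have e := Finset.sum_Ico_eq_sum_range
        (fun n : ℕ => ((n : ℝ) + 1) ^ (-α) • (P ^ n) f) (K * m) (K * m + m)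
      rw [Nat.add_sub_cancel_left] at e
      rw [← e, Finset.sum_Ico_eq_sub _ (Nat.le_add_right _ _)]
      refine (norm_sub_le _ _).trans ?_
      linarith [hG (K * m + m), hG (K * m)]
    have herr : ‖∑ i ∈ Finset.range m, (((K * m + i : ℕ) : ℝ) + 1) ^ (-α) •
        ((P ^ (K * m + i)) f - (P ^ (K * m)) f)‖ ≤ s * (C * ‖f‖ / K) := by
      rw [hs, Finset.sum_mul]
      refine (norm_sum_le _ _).trans (Finset.sum_le_sum fun i hi => ?_)
      rw [norm_smul, Real.norm_of_nonneg (by positivity)]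
      gcongr
      refine (norm_pow_apply_sub_pow_apply_le hC f hKm i).trans ?_
      have him : (i : ℝ) ≤ m := by exact_mod_cast (Finset.mem_range.1 hi).le
      calc _ ≤ (m : ℝ) * (C / ((K * m : ℕ) : ℝ) * ‖f‖) := by gcongr
        _ = _ := by push_cast; field_simp
    have hid : s • (P ^ (K * m)) f
        = ∑ i ∈ Finset.range m, (((K * m + i : ℕ) : ℝ) + 1) ^ (-α) • (P ^ (K * m + i)) f
          - ∑ i ∈ Finset.range m, (((K * m + i : ℕ) : ℝ) + 1) ^ (-α) •
            ((P ^ (K * m + i)) f - (P ^ (K * m)) f) := by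
      rw [← Finset.sum_sub_distrib, hs, Finset.sum_smul]
      refine Finset.sum_congr rfl fun i _ => ?_
      rw [smul_sub, sub_sub_cancel]
    have hn : s * ‖(P ^ (K * m)) f‖ ≤ 2 * G + s * (C * ‖f‖ / K) := by
      rw [← Real.norm_of_nonneg hs0.le, ← norm_smul, Real.norm_of_nonneg hs0.le, hid]
      exact (norm_sub_le _ _).trans (add_le_add hsum herr)
    have hinv : 1 ≤ s * (((K : ℝ) + 1) ^ α * (m : ℝ) ^ (-(1 - α))) := by
      calc (1 : ℝ) = ((m : ℝ) ^ (1 - α) * ((K : ℝ) + 1) ^ (-α)) *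
            (((K : ℝ) + 1) ^ α * (m : ℝ) ^ (-(1 - α))) := by
            rw [Real.rpow_neg hm0.le, Real.rpow_neg (by positivity)]
            field_simp
        _ ≤ _ := by gcongr
    refine le_of_mul_le_mul_left (hn.trans ?_) hs0
    nlinarith [mul_le_mul_of_nonneg_left hinv (show 0 ≤ 2 * G by positivity)]
  have hanti := contraction_antitone_norm_pow_apply hP f
  have hlim := tendsto_atTop_ciInf hanti ⟨0, by rintro _ ⟨n, rfl⟩; exact norm_nonneg _⟩
  set ℓ := ⨅ n : ℕ, ‖(P ^ n) f‖
  have hℓ0 : 0 ≤ ℓ := ge_of_tendsto' hlim fun n => norm_nonneg _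
  have hℓK : ∀ K : ℕ, 1 ≤ K → ℓ ≤ C * ‖f‖ / K := by
    intro K hK
    have hsub : Tendsto (fun m : ℕ => ‖(P ^ (K * m)) f‖) atTop (𝓝 ℓ) :=
      hlim.comp (tendsto_id.const_mul_atTop' hK)
    have hright : Tendsto (fun m : ℕ => 2 * G * ((K : ℝ) + 1) ^ α * (m : ℝ) ^ (-(1 - α))
        + C * ‖f‖ / K) atTop (𝓝 (2 * G * ((K : ℝ) + 1) ^ α * 0 + C * ‖f‖ / K)) :=
      (((tendsto_rpow_neg_atTop (y := 1 - α) (by linarith)).comp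
        tendsto_natCast_atTop_atTop).const_mul _).add_const _
    rw [mul_zero, zero_add] at hright
    refine le_of_tendsto_of_tendsto hsub hright ?_
    filter_upwards [eventually_ge_atTop 1] with m hm using hblock K m hK hm
  have hℓ : ℓ ≤ 0 := by
    refine ge_of_tendsto (tendsto_const_div_atTop_nhds_zero_nat (C * ‖f‖)) ?_
    filter_upwards [eventually_ge_atTop 1] with K hK using hℓK K hK
  rwa [le_antisymm hℓ hℓ0] at hlim

theorem tendsto_fracDiff_apply_sum (hP : ‖P‖ ≤ 1) (h0 : 0 ≤ α) (h1 : α < 1) {C : ℝ}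
    (hC : ∀ n : ℕ, (n : ℝ) * ‖P ^ n * (1 - P)‖ ≤ C) {f : H} {G : ℝ}
    (hG : ∀ N : ℕ, ‖∑ n ∈ Finset.range N, ((n : ℝ) + 1) ^ (-α) • (P ^ n) f‖ ≤ G) :
    Tendsto (fun L : ℕ => fracDiff P α (L + 1)
      (∑ n ∈ Finset.range (L + 1), ((n : ℝ) + 1) ^ (-α) • (P ^ n) f)) atTop (𝓝 f) := by
  have hG0 : 0 ≤ G := by simpa using hG 0
  rw [tendsto_iff_norm_sub_tendsto_zero]
  have hP0 := (tendsto_add_atTop_iff_nat 1).2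
    (tendsto_norm_pow_apply_zero_of_bounded hP h0 h1 hC hG)
  have hB : Tendsto (fun L : ℕ => (((L + 1 : ℕ) : ℝ)) ^ (-(1 - α)) * G) atTop (𝓝 (0 * G)) :=
    (((tendsto_rpow_neg_atTop (y := 1 - α) (by linarith)).comp
      tendsto_natCast_atTop_atTop).comp (tendsto_add_atTop_nat 1)).mul_const G
  have hsum := hP0.add hB
  rw [zero_mul, add_zero] at hsum
  refine squeeze_zero (fun _ => norm_nonneg _) (fun L => ?_) hsum
  refine (norm_fracDiff_apply_sum_sub_le hP h0 f L).trans ?_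
  gcongr
  · have := fracPartial_le h0 L
    push_cast
    rwa [neg_sub]
  · exact hG _

variable [CompleteSpace H]

/-- With K fixed, let the truncation L tend to infinity; the square function bound does not depend
on L. -/
theorem exists_sum_dyadic_norm_sq_le (hP : ‖P‖ ≤ 1) (h0 : 0 ≤ α) (h1 : α < 1) {C : ℝ}
    (hC : ∀ n : ℕ, (n : ℝ) * ‖P ^ n * (1 - P)‖ ≤ C) {f : H} {G : ℝ}
    (hG : ∀ N : ℕ, ‖∑ n ∈ Finset.range N, ((n : ℝ) + 1) ^ (-α) • (P ^ n) f‖ ≤ G) :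
    ∃ D : ℝ, ∀ K : ℕ, ∑ k ∈ Finset.range K,
      (((2 : ℝ) ^ k) ^ (1 - α) * ‖(P ^ (2 * 2 ^ k)) f‖) ^ 2 ≤ D := by
  obtain ⟨D, hD0, hD⟩ := exists_sum_norm_sq_dyadicFracDiff_le hP h0 h1 hC
  refine ⟨D * G ^ 2, fun K => ?_⟩
  have hlim : Tendsto (fun L : ℕ => ∑ k ∈ Finset.range K, ‖dyadicFracDiff P α (L + 1) k
      (∑ n ∈ Finset.range (L + 1), ((n : ℝ) + 1) ^ (-α) • (P ^ n) f)‖ ^ 2) atTop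
      (𝓝 (∑ k ∈ Finset.range K, (((2 : ℝ) ^ k) ^ (1 - α) * ‖(P ^ (2 * 2 ^ k)) f‖) ^ 2)) := by
    refine tendsto_finsetSum _ fun k _ => Tendsto.pow ?_ 2
    have := (((P ^ (2 * 2 ^ k)).continuous.tendsto f).comp
      (tendsto_fracDiff_apply_sum hP h0 h1 hC hG)).norm.const_mul (((2 : ℝ) ^ k) ^ (1 - α))
    refine this.congr fun L => ?_
    rw [dyadicFracDiff, smul_apply, norm_smul, Real.norm_of_nonneg (by positivity)]
    rfl
  refine le_of_tendsto' hlim fun L => (hD _ K _).trans ?_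
  gcongr
  exact hG _

theorem summable_of_bounded (hP : ‖P‖ ≤ 1) (h0 : 0 ≤ α) (h1 : α < 1) {C : ℝ}
    (hC : ∀ n : ℕ, (n : ℝ) * ‖P ^ n * (1 - P)‖ ≤ C) {f : H} {G : ℝ}
    (hG : ∀ N : ℕ, ‖∑ n ∈ Finset.range N, ((n : ℝ) + 1) ^ (-α) • (P ^ n) f‖ ≤ G) :
    Summable fun n : ℕ => ((n : ℝ) + 1) ^ (1 - 2 * α) * ‖(P ^ n) f‖ ^ 2 := by
  obtain ⟨D, hD⟩ := exists_sum_dyadic_norm_sq_le hP h0 h1 hC hG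
  set w : ℕ → ℝ := fun n => ((n : ℝ) + 1) ^ (1 - 2 * α) * ‖(P ^ n) f‖ ^ 2 with hw
  have hw0 : ∀ n, 0 ≤ w n := fun n => by positivity
  have hterm : ∀ k n : ℕ, 2 * 2 ^ k ≤ n → n < 2 * 2 ^ (k + 1) →
      w n ≤ 8 * ((2 : ℝ) ^ k)⁻¹ * (((2 : ℝ) ^ k) ^ (1 - α) * ‖(P ^ (2 * 2 ^ k)) f‖) ^ 2 := by
    intro k n hkn hnk
    have hk : (0 : ℝ) < 2 ^ k := by positivity
    have hn : (0 : ℝ) < (n : ℝ) + 1 := by positivity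
    have hlo : (2 : ℝ) * 2 ^ k ≤ n := by exact_mod_cast hkn
    have hhi : (n : ℝ) + 1 ≤ 4 * 2 ^ k := by
      have : n + 1 ≤ 4 * 2 ^ k := by rw [pow_succ] at hnk; omega
      exact_mod_cast this
    have hpow : ((n : ℝ) + 1) ^ (1 - 2 * α) ≤ 8 * ((2 : ℝ) ^ k)⁻¹ * (((2 : ℝ) ^ k) ^ (1 - α)) ^ 2 := by
      -- The exponent 1 - 2α may have either sign; splitting off (n+1)⁻¹ leaves two factors of known
      -- monotonicity. The constant is 4²/2 = 8.
      have e1 : ((n : ℝ) + 1) ^ (1 - 2 * α) = ((n : ℝ) + 1) ^ (2 - 2 * α) * ((n : ℝ) + 1)⁻¹ := by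
        rw [← Real.rpow_neg_one, ← Real.rpow_add hn]; congr 1; ring
      have e2 : (((2 : ℝ) ^ k) ^ (1 - α)) ^ 2 = ((2 : ℝ) ^ k) ^ (2 - 2 * α) := by
        rw [← Real.rpow_natCast (((2 : ℝ) ^ k) ^ (1 - α)), ← Real.rpow_mul hk.le]
        congr 1; push_cast; ring
      have b1 : ((n : ℝ) + 1) ^ (2 - 2 * α) ≤ 16 * ((2 : ℝ) ^ k) ^ (2 - 2 * α) := by
        calc ((n : ℝ) + 1) ^ (2 - 2 * α) ≤ (4 * 2 ^ k) ^ (2 - 2 * α) :=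
              Real.rpow_le_rpow hn.le hhi (by linarith)
          _ = (4 : ℝ) ^ (2 - 2 * α) * ((2 : ℝ) ^ k) ^ (2 - 2 * α) :=
              Real.mul_rpow (by norm_num) hk.le
          _ ≤ (4 : ℝ) ^ (2 : ℝ) * ((2 : ℝ) ^ k) ^ (2 - 2 * α) := by
              gcongr
              · norm_num
              · linarith
          _ = _ := by norm_num
      have b2 : ((n : ℝ) + 1)⁻¹ ≤ (2 * 2 ^ k)⁻¹ := by
        gcongr
        linarith
      rw [e1, e2]
      calc _ ≤ 16 * ((2 : ℝ) ^ k) ^ (2 - 2 * α) * (2 * 2 ^ k)⁻¹ := by gcongr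
        _ = _ := by rw [mul_inv]; ring
    calc w n ≤ (8 * ((2 : ℝ) ^ k)⁻¹ * (((2 : ℝ) ^ k) ^ (1 - α)) ^ 2) *
          ‖(P ^ (2 * 2 ^ k)) f‖ ^ 2 := by
          simp only [hw]
          gcongr
          exact contraction_antitone_norm_pow_apply hP f hkn
      _ = _ := by ring
  have hdyad : ∀ K : ℕ, ∑ n ∈ Finset.range (2 * 2 ^ K), w n ≤ w 0 + w 1
      + 16 * ∑ k ∈ Finset.range K, (((2 : ℝ) ^ k) ^ (1 - α) * ‖(P ^ (2 * 2 ^ k)) f‖) ^ 2 := by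
    intro K
    induction K with
    | zero => simp [Finset.sum_range_succ]
    | succ K ih =>
      have hle : 2 * 2 ^ K ≤ 2 * 2 ^ (K + 1) := by rw [pow_succ]; omega
      rw [← Finset.sum_range_add_sum_Ico _ hle, Finset.sum_range_succ, mul_add]
      -- The block has 2·2^K terms, which cancels the factor (2^K)⁻¹ and turns 8 into 16.
      have hblk : ∑ n ∈ Finset.Ico (2 * 2 ^ K) (2 * 2 ^ (K + 1)), w n
          ≤ 16 * (((2 : ℝ) ^ K) ^ (1 - α) * ‖(P ^ (2 * 2 ^ K)) f‖) ^ 2 := by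
        refine (Finset.sum_le_sum fun n hn =>
          hterm K n (Finset.mem_Ico.1 hn).1 (Finset.mem_Ico.1 hn).2).trans (le_of_eq ?_)
        rw [Finset.sum_const, Nat.card_Ico, nsmul_eq_mul,
          show 2 * 2 ^ (K + 1) - 2 * 2 ^ K = 2 * 2 ^ K by rw [pow_succ]; omega]
        push_cast
        field_simp
        ring
      linarith
  refine summable_of_sum_range_le (c := w 0 + w 1 + 16 * D) hw0 fun n => ?_
  have hn : n ≤ 2 * 2 ^ n := by
    have := Nat.lt_two_pow_self (n := n)
    omega
  refine (Finset.sum_le_sum_of_subset_of_nonneg (Finset.range_subset_range.2 hn)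
    fun i _ _ => hw0 i).trans ((hdyad n).trans ?_)
  linarith [hD n]

end Reconstruction

/-! ### The main theorem, by restriction to real scalars -/

theorem proposition3p7 {𝕜 H : Type*} [RCLike 𝕜] [NormedAddCommGroup H] [InnerProductSpace 𝕜 H]
    [CompleteSpace H] (P : H →L[𝕜] H) (hP : ‖P‖ ≤ 1) (α : ℝ) (hα0 : 0 ≤ α) (hα1 : α < 1) :
    (∀ f : H, Summable (fun n : ℕ => ((n : ℝ) + 1) ^ (1 - 2 * α) * ‖(P ^ n) f‖ ^ 2) →
      SeriesConverges (fun n : ℕ => ((((n : ℝ) + 1) ^ (-α) : ℝ) : 𝕜) • (P ^ n) f)) ∧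
    (IsRitt P → ∀ f : H,
      SeriesConverges (fun n : ℕ => ((((n : ℝ) + 1) ^ (-α) : ℝ) : 𝕜) • (P ^ n) f) →
        Summable (fun n : ℕ => ((n : ℝ) + 1) ^ (1 - 2 * α) * ‖(P ^ n) f‖ ^ 2)) := by
  -- Both properties and the Ritt condition involve only norms and real coefficients, so P may be
  -- viewed on the underlying real Hilbert space.
  let _ : InnerProductSpace ℝ H := InnerProductSpace.rclikeToReal 𝕜 H
  have hsmul : ∀ (r : ℝ) (x : H), ((r : ℝ) : 𝕜) • x = r • x := fun _ _ => rfl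
  have _ : IsScalarTower ℝ 𝕜 H := RestrictScalars.isScalarTower ℝ 𝕜 H
  set Q : H →L[ℝ] H := P.restrictScalars ℝ with hQ
  have hQP : ∀ (n : ℕ) (x : H), (P ^ n) x = (Q ^ n) x := by
    intro n
    induction n with
    | zero => intro x; rfl
    | succ n ih =>
      intro x
      rw [pow_succ, pow_succ, mul_apply_eq_comp, mul_apply_eq_comp, ih]
      rfl
  have hQ1 : ‖Q‖ ≤ 1 := by rw [hQ, ContinuousLinearMap.norm_restrictScalars]; exact hP
  simp only [hsmul, hQP]
  refine ⟨fun f hf => cauchySeq_tendsto_of_complete (cauchySeq_of_summable hQ1 hα0 hα1 hf), ?_⟩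
  rintro ⟨C, hC⟩ f ⟨g, hg⟩
  have hC' : ∀ n : ℕ, (n : ℝ) * ‖Q ^ n * (1 - Q)‖ ≤ C := by
    intro n
    have h := hC (Set.mem_range_self n)
    have e : Q ^ n * (1 - Q) = (P ^ n - P ^ (n + 1)).restrictScalars ℝ := by
      rw [mul_sub, mul_one, ← pow_succ]
      ext x
      simp [hQP]
    rw [e, ContinuousLinearMap.norm_restrictScalars]
    exact h
  -- Convergence enters only through boundedness of the partial sums.
  obtain ⟨G, hG⟩ := (Metric.isBounded_range_of_tendsto _ hg).exists_norm_le
  exact summable_of_bounded hQ1 hα0 hα1 hC' fun N => hG _ (Set.mem_range_self N)
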